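/- Let $n\ge 2$, let $1\le r\le\infty$, and let $E^r(\mathbb T^n)$ be the space of $C^r$ maps $f:\mathbb T^n\to\mathbb T^n$ of the torus $\mathbb T^n=\mathbb R^n/\mathbb Z^n$ (with the flat metric), endowed with the usual $C^r$ topology. Let $\pi:\mathbb R^n\to\mathbb T^n$ be the projection. Definitions. The map $f$ is volume expanding if there is $\sigma>1$ with $|\det D_xf|>\sigma$ for all $x$; it is expanding in a set $U$ if there is $\lambda>1$ with $\|(D_xf)^{-1}\|^{-1}>\lambda$ for all $x\in U$. On $\mathbb R^n$ write $d(x,y)=\max_i|x_i-y_i|$. Fix a fundamental domain $Q=a+[0,1)^n$, $a\in\mathbb R^n$. For an open set $U\subset\mathbb T^n$ put $\widetilde U=\pi^{-1}(U)\cap Q$, $\operatorname{diam}(U)=\sup\{d(x,y):x,y\in\widetilde U\}$ and $$\operatorname{diam}_{int}(U^c)=\inf_{k\in\mathbb Z^n\setminus\{0\}}\ \inf\{d(x,y+k):x,y\in\widetilde U\}$$ (which is $+\infty$ if $U=\emptyset$). An arc is the image of an injective continuous map $[0,1]\to\mathbb T^n$; its diameter is the diameter, for $d$, of a continuous lift of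 it to $\mathbb R^n$. Theorem. Let $f\in E^r(\mathbb T^n)$ be volume expanding and such that $\bigcup_{k\ge0}f^{-k}(x)$ is dense in $\mathbb T^n$ for every $x\in\mathbb T^n$. Suppose that for some choice of $Q$: 1. there is an open set $U_0\subset\mathbb T^n$ such that $f$ is expanding in $U_0^c$ and $\operatorname{diam}(U_0)<1$; 2. there are $0<\delta_0<\operatorname{diam}_{int}(U_0^c)$ and an open neighborhood $U_1$ of $\overline{U_0}$ such that every arc $\gamma\subset U_0^c$ of diameter larger than $\delta_0$ contains a point $y$ with $f^k(y)\in U_1^c$ for all $k\ge1$; 3. for every $z\in U_1^c$ there is $\bar z\in U_1^c$ with $f(\bar z)=z$. Then there is a neighborhood of $f$ in $E^r(\mathbb T^n)$ such that for every $g$ in it and every $x\in\mathbb T^n$ the set $\bigcup_{k\ge0}g^{-k}(x)$ is dense in $\mathbb T^n$. In particular $f$ is $C^r$-robustly transitive: every $g$ in some $C^r$ neighborhood of $f$ has a dense forward orbit $\{g^k(x)\}_{k\ge0}$ for some $x\in\mathbb T^n$. -/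

import Mathlib

open Set Filter Topology

noncomputable section

/-- The `n`-dimensional torus `ℝⁿ / ℤⁿ`, as a product of `n` circles `ℝ / ℤ`. -/
abbrev Torus (n : ℕ) : Type := Fin n → UnitAddCircle

/-- The universal covering space `ℝⁿ`, with its Euclidean norm. -/
abbrev Cover (n : ℕ) : Type := EuclideanSpace ℝ (Fin n)

/-- The covering projection `ℝⁿ → 𝕋ⁿ`. -/
def proj {n : ℕ} (x : Cover n) : Torus n := fun i => ((x i : ℝ) : UnitAddCircle)

/-- `E^r(𝕋ⁿ)`: the maps of the torus of class `C^r`. Since `ℝⁿ` is simply connected and the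
projection is a local diffeomorphism, these are exactly the maps with a `C^r` lift to `ℝⁿ`.
Here `r` is a natural number or `∞`. -/
structure TorusEndo (n : ℕ) (r : ℕ∞) where
  toFun : Torus n → Torus n
  exists_lift : ∃ F : Cover n → Cover n,
    ContDiff ℝ (r : WithTop ℕ∞) F ∧ ∀ x, proj (F x) = toFun (proj x)

/-- Two continuous lifts of the same map differ by a constant. -/
theorem lift_unique {n : ℕ} {F G : Cover n → Cover n} (hF : Continuous F) (hG : Continuous G)
    (h : ∀ x, proj (F x) = proj (G x)) : ∃ c : Cover n, ∀ x, F x = G x + c := by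
  refine ⟨F 0 - G 0, fun x => ?_⟩
  ext i
  have hcov : IsCoveringMap ((↑) : ℝ → AddCircle (1 : ℝ)) := AddCircle.isCoveringMap_coe 1
  have hi : ∀ x, ((F x i : ℝ) : UnitAddCircle) = ((G x i : ℝ) : UnitAddCircle) :=
    fun x => congrFun (h x) i
  have key := hcov.eq_of_comp_eq (g₁ := fun x : Cover n => F x i)
    (g₂ := fun x : Cover n => G x i + (F 0 i - G 0 i)) (by fun_prop) (by fun_prop)
    (by
      funext y
      have h0 := hi 0
      simp only [Function.comp_apply, AddCircle.coe_add, AddCircle.coe_sub]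
      rw [hi y, h0, sub_self, add_zero])
    0 (by simp)
  simpa using congrFun key x

namespace TorusEndo

variable {n : ℕ} {r : ℕ∞}

instance : CoeFun (TorusEndo n r) (fun _ => Torus n → Torus n) := ⟨TorusEndo.toFun⟩

/-- A lift of `f` to `ℝⁿ`. It is unique up to an additive constant (in `ℤⁿ`), so that its
derivatives of order `≥ 1` do not depend on the choice; they are the derivatives of `f`. -/
def lift (f : TorusEndo n r) : Cover n → Cover n := f.exists_lift.choose

theorem contDiff_lift (f : TorusEndo n r) : ContDiff ℝ (r : WithTop ℕ∞) f.lift :=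
  f.exists_lift.choose_spec.1

theorem proj_lift (f : TorusEndo n r) (x : Cover n) : proj (f.lift x) = f (proj x) :=
  f.exists_lift.choose_spec.2 x

/-- The derivative `D f`, at a point of the torus given by a representative `x ∈ ℝⁿ`. -/
def D (f : TorusEndo n r) (x : Cover n) : Cover n →L[ℝ] Cover n := fderiv ℝ f.lift x

/-- The derivative may be computed with any lift. -/
theorem D_eq (f : TorusEndo n r) {F : Cover n → Cover n} (hF : Continuous F)
    (h : ∀ x, proj (F x) = f (proj x)) (x : Cover n) : f.D x = fderiv ℝ F x := by
  obtain ⟨c, hc⟩ := lift_unique f.contDiff_lift.continuous hF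
    (fun y => (f.proj_lift y).trans (h y).symm)
  have : f.lift = fun y => F y + c := funext hc
  rw [D, this, fderiv_add_const]

/-- The derivative at a point of the torus does not depend on the representative. -/
theorem D_eq_of_proj_eq (f : TorusEndo n r) {x y : Cover n} (hxy : proj x = proj y) :
    f.D x = f.D y := by
  have hlift : ∀ z, proj (f.lift (z + (y - x))) = f (proj z) := by
    intro z
    rw [f.proj_lift]
    congr 1
    funext i
    have := congrFun hxy i
    simp only [proj] at this ⊢
    simp [this]
  have hcont : Continuous fun z => f.lift (z + (y - x)) :=
    f.contDiff_lift.continuous.comp (continuous_id.add continuous_const)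
  rw [f.D_eq hcont hlift x, fderiv_comp_add_right, D]
  congr 1
  abel

/-- The usual `C^r` topology: uniform convergence of the maps and of all their derivatives of
(finite) order `1 ≤ i ≤ r`. -/
instance : TopologicalSpace (TorusEndo n r) :=
  TopologicalSpace.induced (fun f => UniformFun.ofFun f.toFun) inferInstance ⊓
    ⨅ (i : ℕ) (_ : 1 ≤ i) (_ : (i : ℕ∞) ≤ r),
      TopologicalSpace.induced (fun f => UniformFun.ofFun (iteratedFDeriv ℝ i f.lift)) inferInstance

/-- `|det Df| > σ` everywhere, for some `σ > 1`. -/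
def VolumeExpanding (f : TorusEndo n r) : Prop :=
  ∃ σ : ℝ, 1 < σ ∧ ∀ x, σ < |(f.D x).det|

/-- The minimum norm `m{L} = ‖L⁻¹‖⁻¹` of a linear map (it is `0` if `L` is not invertible and
`n ≥ 1`). -/
def minNorm (L : Cover n →L[ℝ] Cover n) : ℝ := ‖L.inverse‖⁻¹

/-- `f` is expanding in the set `U`. -/
def ExpandingOn (f : TorusEndo n r) (U : Set (Torus n)) : Prop :=
  ∃ l : ℝ, 1 < l ∧ ∀ x : Cover n, proj x ∈ U → l < minNorm (f.D x)

/-- The pre-orbit `⋃ₖ f⁻ᵏ(x)`. -/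
def preorbit (f : TorusEndo n r) (x : Torus n) : Set (Torus n) := {w | ∃ k : ℕ, f^[k] w = x}

/-- `f` has a dense forward orbit. -/
def Transitive (f : TorusEndo n r) : Prop := ∃ x, Dense (range fun k : ℕ => f^[k] x)

/-- All maps in some `C^r` neighbourhood of `f` are transitive. -/
def RobustlyTransitive (f : TorusEndo n r) : Prop := ∀ᶠ g in 𝓝 f, g.Transitive

end TorusEndo

/-- The distance `max |xᵢ - yᵢ|` on `ℝⁿ`, as an extended non-negative real. -/
def supEDist {n : ℕ} (x y : Cover n) : ENNReal := ⨆ i, ENNReal.ofReal |x i - y i|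

/-- The diameter of a subset of `ℝⁿ` for the distance `max |xᵢ - yᵢ|`. -/
def supDiam {n : ℕ} (A : Set (Cover n)) : ENNReal := ⨆ (x ∈ A) (y ∈ A), supEDist x y

/-- The lift of `U` restricted to the fundamental domain `a + [0,1)ⁿ`. -/
def frameLift {n : ℕ} (a : Cover n) (U : Set (Torus n)) : Set (Cover n) :=
  {x | (∀ i, a i ≤ x i ∧ x i < a i + 1) ∧ proj x ∈ U}

/-- The internal diameter of `Uᶜ`: with `Ũ` the lift of `U` to the fundamental domain
`a + [0,1)ⁿ`, the infimum over `k ∈ ℤⁿ \ {0}` of the distance between `Ũ` and `Ũ + k`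
(it is `∞` if `U` is empty). -/
def internalDiam {n : ℕ} (a : Cover n) (U : Set (Torus n)) : ENNReal :=
  ⨅ (k : Fin n → ℤ) (_ : k ≠ 0) (x ∈ frameLift a U) (y ∈ frameLift a U),
    supEDist x (y + WithLp.toLp 2 fun i => (k i : ℝ))

/-- `γ` is a lift to `ℝⁿ` of an arc of the torus (an injective continuous image of `[0,1]`). -/
def IsArcLift {n : ℕ} (γ : C(unitInterval, Cover n)) : Prop :=
  Function.Injective fun t => proj (γ t)

end

/-! Everything takes place on `ℝⁿ`. Nonvanishing determinants make `g` near `f` a local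
homeomorphism of the compact torus, hence a covering, and its lifts are homeomorphisms
(`IsLift.exists_homeomorph`). With `W` the lift of `U₀`, the inverse lifts have derivative at most
`L` everywhere and at most `κ < 1` at points whose preimage is off `W`, with the same constants for
all `g` near `f` (`exists_eventually_bounds`, `IsLift.inverseBounds`).

Two facts then give dense pre-orbits for `g`. First, every pre-orbit of `g` meets every ball of a
fixed radius `ρ`: for `f` this happens in bounded time by compactness, and boundedly many backward
steps survive a perturbation (`exists_robust_uniform_preorbit`). Second, some iterate of every path
connected open set contains a ball of radius `ρ` (`exists_eventuallyContainsBall`). Pulling a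
pre-orbit point in that ball back to the open set finishes the argument, and Baire's theorem turns
dense pre-orbits into a dense forward orbit.

For the second fact, volume expansion makes the diameters of the images unbounded. A long path must
either avoid `W` or leave one translate of the small set `Ũ`, and then it reaches another translate
or gets far away; so it contains a connected compact `K` away from `W`, longer than `δ₀`
(`exists_isCompact_isPreconnected_far`). The arc hypothesis speaks of `f`, whereas the orbits needed
are those of `g`. The map `h` of `exists_shadow`, close to the identity, bridges this: if the
`f`-orbit of `h y` stays far from `W`, so does the `g`-orbit of `y`, for a prescribed number of
steps. Near the connected set `h(K)` runs an arc of the torus longer than `δ₀`; its good point lies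
near some `h y` with `y ∈ K`, and small balls about `y` grow under `g` to the definite radius
(`ball_subset_iterate_image`). -/

theorem isOpenMap_iterate {X : Type*} [TopologicalSpace X] {f : X → X} (hf : IsOpenMap f) (k : ℕ) :
    IsOpenMap f^[k] := by
  induction k with
  | zero => exact IsOpenMap.id
  | succ k ih => rw [Function.iterate_succ]; exact ih.comp hf

/-! ### The covering projection -/

section Projection

variable {n : ℕ}

/-- The integer vector `k`, as an element of `ℝⁿ`. -/
noncomputable def intVec (k : Fin n → ℤ) : Cover n := WithLp.toLp 2 fun i => (k i : ℝ)

@[simp] theorem intVec_apply (k : Fin n → ℤ) (i : Fin n) : intVec k i = k i := rfl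

theorem continuous_proj : Continuous (proj : Cover n → Torus n) :=
  continuous_pi fun i => (AddCircle.continuous_mk' 1).comp (by fun_prop)

theorem proj_eq_proj_iff {x y : Cover n} : proj x = proj y ↔ ∃ k, y = x + intVec k := by
  constructor
  · intro h
    have : ∀ i, ∃ m : ℤ, y i = x i + m := by
      intro i
      have hi : ((y i - x i : ℝ) : UnitAddCircle) = 0 := by
        rw [AddCircle.coe_sub, sub_eq_zero]
        exact (congrFun h i).symm
      obtain ⟨m, hm⟩ := (AddCircle.coe_eq_zero_iff 1).1 hi
      exact ⟨m, by simp at hm; linarith⟩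
    choose k hk using this
    exact ⟨k, by ext i; simpa using hk i⟩
  · rintro ⟨k, rfl⟩
    funext i
    simp only [proj, PiLp.add_apply, intVec_apply, AddCircle.coe_add]
    have : ((k i : ℝ) : UnitAddCircle) = 0 :=
      (AddCircle.coe_eq_zero_iff 1).2 ⟨k i, by simp⟩
    rw [this, add_zero]

@[simp] theorem proj_add_intVec (x : Cover n) (k : Fin n → ℤ) : proj (x + intVec k) = proj x :=
  (proj_eq_proj_iff.2 ⟨k, rfl⟩).symm

theorem exists_proj_eq_mem_box (a : Cover n) (x : Torus n) :
    ∃ y : Cover n, proj y = x ∧ ∀ i, a i ≤ y i ∧ y i < a i + 1 := by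
  have : ∀ i, ∃ t : ℝ, (t : UnitAddCircle) = x i ∧ a i ≤ t ∧ t < a i + 1 := by
    intro i
    obtain ⟨t, ht, h⟩ := (AddCircle.coe_image_Ico_eq 1 (a i)).symm ▸ mem_univ (x i)
    exact ⟨t, h, ht.1, ht.2⟩
  choose t ht using this
  exact ⟨WithLp.toLp 2 t, funext fun i => (ht i).1, fun i => (ht i).2⟩

theorem proj_surjective : Function.Surjective (proj : Cover n → Torus n) := fun x =>
  let ⟨y, hy, _⟩ := exists_proj_eq_mem_box 0 x
  ⟨y, hy⟩

theorem isCompact_box (a b : Cover n) : IsCompact {y : Cover n | ∀ i, a i ≤ y i ∧ y i ≤ b i} := by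
  have h := (isCompact_univ_pi fun i => isCompact_Icc (a := a i) (b := b i)).image
    (PiLp.continuous_toLp 2 fun _ : Fin n => ℝ)
  refine h.of_isClosed_subset ?_ ?_
  · rw [ofPred_forall]
    refine isClosed_iInter fun i => ?_
    have hi : Continuous fun y : Cover n => y i := by fun_prop
    exact (isClosed_le continuous_const hi).inter (isClosed_le hi continuous_const)
  · intro y hy
    exact ⟨WithLp.ofLp y, fun i _ => hy i, by simp⟩

theorem isOpenMap_proj : IsOpenMap (proj : Cover n → Torus n) := by
  have h : IsOpenMap (Pi.map fun (_ : Fin n) (t : ℝ) => (t : UnitAddCircle)) :=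
    IsOpenMap.piMap (fun _ => QuotientAddGroup.isOpenMap_coe)
      (Eventually.of_forall fun _ => QuotientAddGroup.mk_surjective)
  exact h.comp (PiLp.homeomorph 2 fun _ : Fin n => ℝ).isOpenMap

theorem isQuotientMap_proj : IsQuotientMap (proj : Cover n → Torus n) :=
  isOpenMap_proj.isQuotientMap continuous_proj proj_surjective

theorem abs_apply_sub_le_dist (x y : Cover n) (i : Fin n) : |x i - y i| ≤ dist x y := by
  rw [dist_eq_norm]
  simpa using PiLp.norm_apply_le (x - y) i

theorem dist_proj_le (x y : Cover n) : dist (proj x) (proj y) ≤ dist x y := by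
  refine (dist_pi_le_iff dist_nonneg).2 fun i => ?_
  refine le_trans ?_ (abs_apply_sub_le_dist x y i)
  rw [dist_eq_norm]
  simp only [proj, ← AddCircle.coe_sub]
  rw [UnitAddCircle.norm_eq]
  simpa using round_le (x i - y i) 0

theorem one_le_abs_of_ne {k : Fin n → ℤ} (hk : k ≠ 0) : ∃ i, (1 : ℝ) ≤ |(k i : ℝ)| := by
  obtain ⟨i, hi⟩ := Function.ne_iff.1 hk
  exact ⟨i, by exact_mod_cast Int.one_le_abs hi⟩

theorem isLocalHomeomorph_proj : IsLocalHomeomorph (proj : Cover n → Torus n) := by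
  rw [isLocalHomeomorph_iff_isOpenEmbedding_restrict]
  intro x
  refine ⟨Metric.ball x (1 / 2), Metric.ball_mem_nhds x (by norm_num), ?_⟩
  refine IsOpenEmbedding.of_continuous_injective_isOpenMap
    (continuous_proj.comp continuous_subtype_val) ?_
    (isOpenMap_proj.comp Metric.isOpen_ball.isOpenMap_subtype_val)
  rintro ⟨y, hy⟩ ⟨z, hz⟩ h
  obtain ⟨k, hk⟩ := proj_eq_proj_iff.1 h
  replace hk : z = y + intVec k := hk
  rw [Subtype.mk.injEq]
  by_contra hne
  have hk0 : k ≠ 0 := by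
    rintro rfl
    apply hne
    rw [hk]; ext i; simp
  obtain ⟨i, hi⟩ := one_le_abs_of_ne hk0
  have h1 := abs_apply_sub_le_dist z y i
  have h2 : dist z y < 1 := by
    have := dist_triangle_right z y x
    rw [Metric.mem_ball] at hy hz
    linarith
  have h3 : z i - y i = k i := by rw [hk]; simp
  rw [h3] at h1
  linarith

/-- Maps into `ℝⁿ` with the same projection which agree at a point are equal. -/
theorem eq_of_proj_comp_eq {A : Type*} [TopologicalSpace A] [PreconnectedSpace A]
    {S T : A → Cover n} (hS : Continuous S) (hT : Continuous T)
    (h : ∀ a, proj (S a) = proj (T a)) (a₀ : A) (h₀ : S a₀ = T a₀) : S = T := by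
  funext a
  ext i
  have key := (AddCircle.isCoveringMap_coe (1 : ℝ)).eq_of_comp_eq
    (g₁ := fun a => S a i) (g₂ := fun a => T a i) (by fun_prop) (by fun_prop)
    (funext fun a => congrFun (h a) i) a₀ (by rw [h₀])
  exact congrFun key a

/-- Maps of `ℝⁿ` to the torus lift to `ℝⁿ`. -/
theorem exists_lift_of_continuous {m : ℕ} {S : Cover m → Torus n} (hS : Continuous S)
    (x₀ : Cover m) (y₀ : Cover n) (h₀ : proj y₀ = S x₀) :
    ∃ T : Cover m → Cover n, Continuous T ∧ T x₀ = y₀ ∧ ∀ x, proj (T x) = S x := by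
  have : ∀ i, ∃ t : C(Cover m, ℝ), t x₀ = y₀ i ∧ ∀ x, ((t x : ℝ) : UnitAddCircle) = S x i := by
    intro i
    obtain ⟨t, ⟨ht, ht'⟩, -⟩ :=
      (AddCircle.isCoveringMap_coe (1 : ℝ)).existsUnique_continuousMap_lifts
      ⟨fun x => S x i, by fun_prop⟩ x₀ (y₀ i) (congrFun h₀ i)
    exact ⟨t, ht, fun x => congrFun ht' x⟩
  choose t ht ht' using this
  refine ⟨fun x => WithLp.toLp 2 fun i => t i x, ?_, ?_, fun x => funext fun i => ht' i x⟩
  · exact (PiLp.continuous_toLp 2 _).comp (continuous_pi fun i => (t i).continuous)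
  · ext i; exact ht i

end Projection

/-! ### Lifts of an endomorphism -/

namespace TorusEndo

variable {n : ℕ} {r : ℕ∞}

/-- `G` is a continuous lift of `g` to `ℝⁿ`. -/
def IsLift (g : TorusEndo n r) (G : Cover n → Cover n) : Prop :=
  Continuous G ∧ ∀ x, proj (G x) = g (proj x)

theorem isLift_lift (g : TorusEndo n r) : g.IsLift g.lift :=
  ⟨g.contDiff_lift.continuous, g.proj_lift⟩

protected theorem continuous (g : TorusEndo n r) : Continuous g := by
  rw [isQuotientMap_proj.continuous_iff]
  have : (g : Torus n → Torus n) ∘ proj = proj ∘ g.lift := funext fun x => (g.proj_lift x).symm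
  rw [this]
  exact continuous_proj.comp g.contDiff_lift.continuous

theorem IsLift.hasStrictFDerivAt {g : TorusEndo n r} {G : Cover n → Cover n} (hG : g.IsLift G)
    (hr : 1 ≤ r) (x : Cover n) : HasStrictFDerivAt G (g.D x) x := by
  obtain ⟨c, hc⟩ := lift_unique hG.1 g.contDiff_lift.continuous
    (fun y => (hG.2 y).trans (g.proj_lift y).symm)
  have hG' : G = fun y => g.lift y + c := funext hc
  rw [hG']
  refine HasStrictFDerivAt.add_const c (g.contDiff_lift.contDiffAt.hasStrictFDerivAt ?_)
  have : r ≠ 0 := by rintro rfl; simp at hr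
  simpa using this

theorem IsLift.hasFDerivAt {g : TorusEndo n r} {G : Cover n → Cover n} (hG : g.IsLift G)
    (hr : 1 ≤ r) (x : Cover n) : HasFDerivAt G (g.D x) x :=
  (hG.hasStrictFDerivAt hr x).hasFDerivAt

theorem IsLift.iterate {g : TorusEndo n r} {G : Cover n → Cover n} (hG : g.IsLift G) (k : ℕ)
    (x : Cover n) : proj (G^[k] x) = g^[k] (proj x) := by
  induction k generalizing x with
  | zero => rfl
  | succ k ih => rw [Function.iterate_succ_apply, ih, hG.2, Function.iterate_succ_apply]

theorem continuous_D (g : TorusEndo n r) (hr : 1 ≤ r) : Continuous g.D :=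
  g.contDiff_lift.continuous_fderiv (by
    have : r ≠ 0 := by rintro rfl; simp at hr
    simpa using this)

/-- By periodicity all values of the derivative are attained on a unit box. This is the source of
the uniform derivative constants on the noncompact cover. -/
theorem isCompact_range_D (g : TorusEndo n r) (hr : 1 ≤ r) : IsCompact (range g.D) := by
  have h := (isCompact_box (0 : Cover n) (WithLp.toLp 2 fun _ => 1)).image (g.continuous_D hr)
  convert h using 1
  refine (range_subset_iff.2 fun x => ?_).antisymm (image_subset_range _ _)
  obtain ⟨y, hy, hy'⟩ := exists_proj_eq_mem_box 0 (proj x)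
  refine ⟨y, fun i => ⟨(hy' i).1, by simpa using (hy' i).2.le⟩, g.D_eq_of_proj_eq hy⟩

/-- A torus endomorphism with invertible derivatives is a local homeomorphism. -/
theorem isLocalHomeomorph (g : TorusEndo n r) (hr : 1 ≤ r) (hdet : ∀ x, (g.D x).det ≠ 0) :
    IsLocalHomeomorph g := by
  have hlift : IsLocalHomeomorph g.lift := by
    refine IsLocalHomeomorph.mk _ fun x => ?_
    have hs : HasStrictFDerivAt g.lift
        (((g.D x).toContinuousLinearEquivOfDetNeZero (hdet x) : Cover n ≃L[ℝ] Cover n) :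
          Cover n →L[ℝ] Cover n) x := by
      simpa using g.isLift_lift.hasStrictFDerivAt hr x
    exact ⟨hs.toOpenPartialHomeomorph, hs.mem_toOpenPartialHomeomorph_source,
      fun y _ => by rw [hs.toOpenPartialHomeomorph_coe]⟩
  have hcomp : (g : Torus n → Torus n) ∘ proj = proj ∘ g.lift :=
    funext fun x => (g.proj_lift x).symm
  have h1 : IsLocalHomeomorph ((g : Torus n → Torus n) ∘ proj) := by
    rw [hcomp]; exact isLocalHomeomorph_proj.comp hlift
  rw [isLocalHomeomorph_iff_isLocalHomeomorphOn_univ]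
  have := IsLocalHomeomorphOn.of_comp_right (s := univ) h1.isLocalHomeomorphOn
    isLocalHomeomorph_proj.isLocalHomeomorphOn
  rwa [image_univ, proj_surjective.range_eq] at this

/-- A lift of a torus endomorphism with invertible derivatives is a homeomorphism. -/
theorem IsLift.exists_homeomorph {g : TorusEndo n r} {G : Cover n → Cover n} (hG : g.IsLift G)
    (hr : 1 ≤ r) (hdet : ∀ x, (g.D x).det ≠ 0) : ∃ e : Cover n ≃ₜ Cover n, ⇑e = G := by
  have hcov : IsCoveringMap g := isLocalHomeomorph_iff_isCoveringMap.1 (g.isLocalHomeomorph hr hdet)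
  -- The inverse is built by lifting twice: `proj` through the covering `g`, then the result through
  -- `proj`. Uniqueness of lifts makes both compositions with `G` the identity.
  obtain ⟨S, ⟨hS0, hS⟩, -⟩ := hcov.existsUnique_continuousMap_lifts
    ⟨proj, continuous_proj⟩ (G 0) (proj 0) (hG.2 0).symm
  obtain ⟨T, hT, hT0, hTS⟩ := exists_lift_of_continuous S.continuous (G 0) 0 hS0.symm
  have hgS : ∀ x, g (S x) = proj x := fun x => congrFun hS x
  have hGT : G ∘ T = id := by
    refine eq_of_proj_comp_eq (hG.1.comp hT) continuous_id (fun x => ?_) (G 0) ?_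
    · simp only [Function.comp_apply, id, hG.2, hTS, hgS]
    · simp [hT0]
  have hTG : T ∘ G = id := by
    have h := hcov.eq_of_comp_eq (g₁ := fun x => proj (T (G x))) (g₂ := proj)
      (continuous_proj.comp (hT.comp hG.1)) continuous_proj
      (funext fun x => by simp only [Function.comp_apply, hTS, hgS, hG.2]) 0 (by rw [hT0])
    exact eq_of_proj_comp_eq (hT.comp hG.1) continuous_id (fun x => congrFun h x) 0
      (by simp [hT0])
  exact ⟨⟨⟨G, T, congrFun hTG, congrFun hGT⟩, hG.1, hT⟩, rfl⟩

end TorusEndo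

/-- The derivative of the inverse of a homeomorphism, with a bound on its norm. -/
theorem Homeomorph.exists_hasFDerivAt_symm {n : ℕ} (e : Cover n ≃ₜ Cover n)
    {L : Cover n →L[ℝ] Cover n} (v : Cover n) (he : HasFDerivAt e L (e.symm v))
    {c : ℝ} (hc : 0 < c) (hL : ∀ w, c * ‖w‖ ≤ ‖L w‖) :
    ∃ L' : Cover n →L[ℝ] Cover n, HasFDerivAt e.symm L' v ∧ ‖L'‖ ≤ c⁻¹ := by
  have hinj : Function.Injective L := by
    rw [injective_iff_map_eq_zero]
    intro w hw
    have := hL w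
    rw [hw, norm_zero] at this
    exact norm_le_zero_iff.1 (nonpos_of_mul_nonpos_right this hc)
  let M : Cover n ≃L[ℝ] Cover n :=
    (LinearEquiv.ofInjectiveEndo (L : Cover n →ₗ[ℝ] Cover n) hinj).toContinuousLinearEquiv
  have hM : (M : Cover n →L[ℝ] Cover n) = L := by ext1 w; rfl
  refine ⟨M.symm, HasFDerivAt.of_local_left_inverse e.symm.continuous.continuousAt
    (by rw [hM]; exact he) (Eventually.of_forall e.apply_symm_apply), ?_⟩
  refine ContinuousLinearMap.opNorm_le_bound _ (inv_nonneg.2 hc.le) fun w => ?_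
  have h1 := hL (M.symm w)
  have h2 : L (M.symm w) = w := by rw [← hM]; exact M.apply_symm_apply w
  rw [h2] at h1
  rw [inv_mul_eq_div, le_div_iff₀ hc, mul_comm]
  exact h1

/-! ### Neighbourhoods in the `C^r` topology -/

/-- A continuous real function which is uniformly close to the integers is uniformly close to one
integer. -/
theorem exists_int_abs_sub_le {X : Type*} [TopologicalSpace X] [PreconnectedSpace X]
    [Nonempty X] {u : X → ℝ} (hu : Continuous u) {ε : ℝ} (hε : ε < 1 / 4)
    (h : ∀ x, ‖((u x : ℝ) : UnitAddCircle)‖ ≤ ε) : ∃ m : ℤ, ∀ x, |u x - m| ≤ ε := by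
  obtain ⟨x₀⟩ := ‹Nonempty X›
  have hround : ∀ x, |u x - round (u x)| ≤ ε := fun x => by
    rw [← UnitAddCircle.norm_eq]; exact h x
  refine ⟨round (u x₀), ?_⟩
  -- The values avoid the gaps between the `ε`-neighbourhoods of the integers, so the closed
  -- condition `≤ ε` coincides with the open condition `< 1 / 2`.
  have hclopen : IsClopen {x | |u x - round (u x₀)| ≤ ε} := by
    refine ⟨isClosed_le (by fun_prop) continuous_const, ?_⟩
    have : {x | |u x - round (u x₀)| ≤ ε} = {x | |u x - round (u x₀)| < 1 / 2} := by
      ext x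
      simp only [mem_ofPred_eq]
      refine ⟨fun hx => by linarith, fun hx => ?_⟩
      have hint : |((round (u x) - round (u x₀) : ℤ) : ℝ)| < 1 := by
        have h1 := abs_sub_abs_le_abs_sub (u x - round (u x₀)) (u x - round (u x))
        have h2 := abs_sub (u x - (round (u x₀) : ℝ)) (u x - round (u x))
        have h3 := hround x
        have h4 : ((round (u x) - round (u x₀) : ℤ) : ℝ)
            = (u x - round (u x₀)) - (u x - round (u x)) := by push_cast; ring
        rw [h4]
        linarith
      have : round (u x) - round (u x₀) = 0 := by
        rw [← Int.abs_lt_one_iff]; exact_mod_cast hint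
      rw [← sub_eq_zero.1 this]
      exact hround x
    rw [this]
    exact isOpen_lt (by fun_prop) continuous_const
  have huniv := hclopen.eq_univ ⟨x₀, hround x₀⟩
  intro x
  exact (huniv ▸ mem_univ x : x ∈ {x | |u x - round (u x₀)| ≤ ε})

theorem Cover.norm_le_of_forall_abs_le {n : ℕ} {x : Cover n} {ε : ℝ} (hε : 0 ≤ ε)
    (h : ∀ i, |x i| ≤ ε) : ‖x‖ ≤ (n : ℝ) * ε := by
  rw [EuclideanSpace.norm_eq]
  refine Real.sqrt_le_iff.2 ⟨by positivity, ?_⟩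
  calc ∑ i, ‖x i‖ ^ 2 ≤ ∑ _i : Fin n, ε ^ 2 :=
        Finset.sum_le_sum fun i _ => pow_le_pow_left₀ (norm_nonneg _) (h i) 2
    _ = n * ε ^ 2 := by simp
    _ ≤ (n * ε) ^ 2 := by
        rw [mul_pow]
        refine mul_le_mul_of_nonneg_right ?_ (by positivity)
        have : (n : ℝ) ≤ n * n := by exact_mod_cast Nat.le_mul_self n
        rwa [pow_two]

namespace TorusEndo

variable {n : ℕ} {r : ℕ∞}

theorem eventually_dist_lt (f : TorusEndo n r) {δ : ℝ} (hδ : 0 < δ) :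
    ∀ᶠ g : TorusEndo n r in 𝓝 f, ∀ x, dist (f x) (g x) < δ := by
  have hc : Continuous fun g : TorusEndo n r => UniformFun.ofFun g.toFun :=
    continuous_iff_le_induced.2 inf_le_left
  exact (hc.tendsto f).eventually
    ((UniformFun.hasBasis_nhds _ _ _).mem_of_mem (Metric.dist_mem_uniformity hδ))

theorem eventually_norm_D_sub_le (f : TorusEndo n r) (hr : 1 ≤ r) {δ : ℝ} (hδ : 0 < δ) :
    ∀ᶠ g : TorusEndo n r in 𝓝 f, ∀ x, ‖f.D x - g.D x‖ ≤ δ := by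
  have hc : Continuous fun g : TorusEndo n r => UniformFun.ofFun (iteratedFDeriv ℝ 1 g.lift) :=
    continuous_iff_le_induced.2 (inf_le_right.trans
      (iInf_le_of_le 1 (iInf_le_of_le le_rfl (iInf_le_of_le (by exact_mod_cast hr) le_rfl))))
  filter_upwards [(hc.tendsto f).eventually
    ((UniformFun.hasBasis_nhds _ _ _).mem_of_mem (Metric.dist_mem_uniformity hδ))] with g hg x
  have hx : dist (iteratedFDeriv ℝ 1 f.lift x) (iteratedFDeriv ℝ 1 g.lift x) < δ := hg x
  rw [dist_eq_norm] at hx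
  refine ContinuousLinearMap.opNorm_le_bound _ hδ.le fun v => ?_
  have h1 := (iteratedFDeriv ℝ 1 f.lift x - iteratedFDeriv ℝ 1 g.lift x).le_opNorm fun _ => v
  simp only [sub_apply, iteratedFDeriv_one_apply, Finset.univ_unique,
    Finset.prod_const, Finset.card_singleton, pow_one] at h1
  exact h1.trans (mul_le_mul_of_nonneg_right hx.le (norm_nonneg v))

/-- Maps close to `f` have lifts close to a given lift of `f`. -/
theorem eventually_exists_isLift (f : TorusEndo n r) {F : Cover n → Cover n} (hF : f.IsLift F)
    {δ : ℝ} (hδ : 0 < δ) :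
    ∀ᶠ g : TorusEndo n r in 𝓝 f, ∃ G, g.IsLift G ∧ ∀ x, dist (G x) (F x) ≤ δ := by
  obtain ⟨ε, hε, hε4, hεn⟩ : ∃ ε : ℝ, 0 < ε ∧ ε < 1 / 4 ∧ n * ε ≤ δ := by
    refine ⟨min (1 / 8) (δ / (n + 1)), by positivity, ?_, ?_⟩
    · exact (min_le_left _ _).trans_lt (by norm_num)
    · calc (n : ℝ) * min (1 / 8) (δ / (n + 1)) ≤ (n + 1) * (δ / (n + 1)) := by
            gcongr
            · linarith
            · exact min_le_right _ _
        _ = δ := by field_simp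
  filter_upwards [f.eventually_dist_lt hε] with g hg
  have : ∀ i, ∃ m : ℤ, ∀ x, |(g.lift x i - F x i) - m| ≤ ε := by
    intro i
    have hFc := hF.1
    have hgc := g.contDiff_lift.continuous
    refine exists_int_abs_sub_le (by fun_prop) hε4 fun x => ?_
    rw [AddCircle.coe_sub]
    have h1 := (dist_le_pi_dist (f (proj x)) (g (proj x)) i).trans (hg _).le
    rw [← hF.2, ← g.proj_lift, dist_comm, dist_eq_norm] at h1
    exact h1
  choose m hm using this
  refine ⟨fun x => g.lift x + intVec (-m), ⟨g.contDiff_lift.continuous.add continuous_const,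
    fun x => by rw [proj_add_intVec, g.proj_lift]⟩, fun x => ?_⟩
  rw [dist_eq_norm]
  refine (Cover.norm_le_of_forall_abs_le hε.le fun i => ?_).trans hεn
  convert hm i x using 2
  simp
  ring

end TorusEndo

/-! ### Homeomorphisms of a normed space expanding outside a set -/

section Dynamics

variable {E : Type*} [NormedAddCommGroup E] [NormedSpace ℝ E]

/-- The inverse of `e` has derivatives of norm at most `L`, and at most `κ` at the points with
preimage outside `W`. -/
def InverseBounds (e : E ≃ₜ E) (W : Set E) (L κ : ℝ) : Prop :=
  ∀ v, ∃ H : E →L[ℝ] E, HasFDerivAt e.symm H v ∧ ‖H‖ ≤ L ∧ (e.symm v ∉ W → ‖H‖ ≤ κ)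

namespace InverseBounds

variable {e e' : E ≃ₜ E} {W : Set E} {L κ η : ℝ}

theorem nonneg (hb : InverseBounds e W L κ) : 0 ≤ L := by
  obtain ⟨H, -, hH, -⟩ := hb 0
  exact (norm_nonneg H).trans hH

theorem dist_symm_le (hb : InverseBounds e W L κ) (u v : E) :
    dist (e.symm u) (e.symm v) ≤ L * dist u v := by
  choose H hH hL _ using hb
  rw [dist_eq_norm, dist_eq_norm]
  exact convex_univ.norm_image_sub_le_of_norm_hasFDerivWithin_le
    (fun x _ => (hH x).hasFDerivWithinAt) (fun x _ => hL x) (mem_univ v) (mem_univ u)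

/-- Near the image of a point far from `W`, the inverse contracts. -/
theorem dist_symm_le_of_far (hb : InverseBounds e W L κ) {y v : E}
    (hy : ∀ w ∈ W, η ≤ dist w y) (hv : L * dist v (e y) < η) :
    dist (e.symm v) y ≤ κ * dist v (e y) := by
  -- The Lipschitz bound `L` keeps the preimage of the whole segment within `η` of `y`, hence off
  -- `W`; the mean value inequality then applies on the segment with constant `κ`.
  have hfar : ∀ p ∈ segment ℝ (e y) v, e.symm p ∉ W := by
    intro p hp hpW
    have h1 := hb.dist_symm_le p (e y)
    rw [e.symm_apply_apply] at h1
    have h2 : dist p (e y) ≤ dist v (e y) := by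
      obtain ⟨t, ht, rfl⟩ := (segment_eq_image_lineMap ℝ (e y) v) ▸ hp
      rw [dist_lineMap_left, Real.norm_of_nonneg ht.1, dist_comm v]
      exact mul_le_of_le_one_left dist_nonneg ht.2
    have h3 := hy _ hpW
    have h4 := mul_le_mul_of_nonneg_left h2 hb.nonneg
    linarith
  choose H hH _ hκ using hb
  have := (convex_segment (𝕜 := ℝ) (e y) v).norm_image_sub_le_of_norm_hasFDerivWithin_le
    (fun x _ => (hH x).hasFDerivWithinAt) (fun x hx => hκ x (hfar x hx))
    (left_mem_segment ℝ _ _) (right_mem_segment ℝ _ _)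
  rwa [e.symm_apply_apply, ← dist_eq_norm, ← dist_eq_norm] at this

/-- Balls grow along an orbit which stays far from `W`. -/
theorem ball_subset_iterate_image (hb : InverseBounds e W L κ) (hκ : 0 < κ) (hκ1 : κ ≤ 1)
    {ρ s : ℝ} (hρ : L * ρ < η) {O : Set E} {y : E} (hO : Metric.ball y s ⊆ O) (m : ℕ) {R : ℝ}
    (hy : ∀ k < m, ∀ w ∈ W, η ≤ dist w (e^[k] y)) (hR : R ≤ ρ) (hRs : R * κ ^ m ≤ s) :
    Metric.ball (e^[m] y) R ⊆ e^[m] '' O := by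
  induction m generalizing R with
  | zero =>
    simp only [Function.iterate_zero, id, image_id]
    exact (Metric.ball_subset_ball (by simpa using hRs)).trans hO
  | succ m ih =>
    intro z hz
    rw [Function.iterate_succ_apply', Metric.mem_ball] at hz
    have hRpos : 0 < R := dist_nonneg.trans_lt hz
    have h1 : dist (e.symm z) (e^[m] y) ≤ κ * dist z (e (e^[m] y)) := by
      refine hb.dist_symm_le_of_far (hy m m.lt_succ_self) (lt_of_le_of_lt ?_ hρ)
      exact mul_le_mul_of_nonneg_left (hz.le.trans hR) hb.nonneg
    -- The last step is undone first: the preimage of a ball of radius `R` lies in a ball of radius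
    -- `κ * R`, which is why the induction is over all radii.
    have h2 := ih (R := κ * R) (fun k hk => hy k (hk.trans m.lt_succ_self))
      ((mul_le_of_le_one_left hRpos.le hκ1).trans hR) (by rw [pow_succ] at hRs; linarith)
    obtain ⟨o, ho, hoz⟩ := h2 (Metric.mem_ball.2 (h1.trans_lt (by gcongr)))
    exact ⟨o, ho, by rw [Function.iterate_succ_apply', hoz, e.apply_symm_apply]⟩

/-- A perturbation `e'` of `e` is followed by `e`, through a map close to the identity, as long as
the orbits stay far from `W`. -/
theorem exists_shadow (hb : InverseBounds e W L κ) (hκ : 0 ≤ κ) {ε δ : ℝ}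
    (hε : 0 ≤ ε) (hεη : ε ≤ η) (hη : 0 < η) (hεδ : κ * (ε + δ) ≤ ε) (hL : L * (ε + δ) < η)
    (hδ : ∀ x, dist (e' x) (e x) ≤ δ) (m : ℕ) :
    ∃ h : E → E, Continuous h ∧ (∀ y, dist (h y) y ≤ ε) ∧
      ∀ y, 2 * η ≤ Metric.infDist y W →
        (∀ k, 1 ≤ k → k ≤ m → 3 * η ≤ Metric.infDist (e^[k] (h y)) W) →
        ∀ k ≤ m, 2 * η ≤ Metric.infDist (e'^[k] y) W := by
  induction m with
  | zero =>
    refine ⟨id, continuous_id, fun y => by simpa using hε, fun y hy _ k hk => ?_⟩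
    obtain rfl : k = 0 := by omega
    exact hy
  | succ m ih =>
    obtain ⟨h, hc, hd, hsh⟩ := ih
    -- A cutoff equal to 0 within `η` of `W` and to 1 at distance at least `2 * η`. The new map is
    -- `e⁻¹ ∘ h ∘ e'` far from `W` and the identity near it. Where it moves points the contraction
    -- applies, so its displacement is at most `κ * (ε + δ) ≤ ε`.
    let χ : E → ℝ := fun y => max 0 (min 1 (η⁻¹ * (Metric.infDist y W - η)))
    have hχc : Continuous χ := by
      have := Metric.continuous_infDist_pt W
      fun_prop
    have hχ0 : ∀ y, Metric.infDist y W ≤ η → χ y = 0 := fun y hy =>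
      max_eq_left ((min_le_right _ _).trans
        (mul_nonpos_of_nonneg_of_nonpos (inv_nonneg.2 hη.le) (by linarith)))
    have hχ1 : ∀ y, 2 * η ≤ Metric.infDist y W → χ y = 1 := fun y hy => by
      have : 1 ≤ η⁻¹ * (Metric.infDist y W - η) := by
        rw [inv_mul_eq_div, le_div_iff₀ hη]; linarith
      simp only [χ, min_eq_left this]
      norm_num
    have hχ : ∀ y, 0 ≤ χ y ∧ χ y ≤ 1 := fun y =>
      ⟨le_max_left _ _, max_le zero_le_one (min_le_left _ _)⟩
    refine ⟨fun y => y + χ y • (e.symm (h (e' y)) - y), ?_, fun y => ?_, fun y hy hF k hk => ?_⟩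
    · have := e.symm.continuous
      have := e'.continuous
      fun_prop
    · rw [dist_eq_norm, add_sub_cancel_left, norm_smul, Real.norm_of_nonneg (hχ y).1]
      by_cases hy : Metric.infDist y W ≤ η
      · rw [hχ0 y hy, zero_mul]; exact hε
      · refine (mul_le_of_le_one_left (norm_nonneg _) (hχ y).2).trans ?_
        rw [← dist_eq_norm]
        have h1 : dist (h (e' y)) (e y) ≤ ε + δ :=
          (dist_triangle _ (e' y) _).trans (add_le_add (hd _) (hδ y))
        refine (hb.dist_symm_le_of_far (η := η) (fun w hw => ?_) (lt_of_le_of_lt ?_ hL)).trans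
          ((mul_le_mul_of_nonneg_left h1 hκ).trans hεδ)
        · rw [dist_comm]
          exact (not_le.1 hy).le.trans (Metric.infDist_le_dist_of_mem hw)
        · exact mul_le_mul_of_nonneg_left h1 hb.nonneg
    -- Where the cutoff is 1 the new map conjugates one step of `e'` to one step of `e`. The margin
    -- `3 * η` drops to `2 * η` because `h` moves points by at most `ε ≤ η`.
    · have heq : e (y + χ y • (e.symm (h (e' y)) - y)) = h (e' y) := by
        rw [hχ1 y hy, one_smul, add_sub_cancel, e.apply_symm_apply]
      rcases k with _ | k
      · exact hy
      · rw [Function.iterate_succ_apply]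
        refine hsh (e' y) ?_ (fun j hj1 hj => ?_) k (by omega)
        · have h1 := hF 1 le_rfl (by omega)
          rw [Function.iterate_one, heq] at h1
          have h2 := Metric.infDist_le_infDist_add_dist (s := W) (x := h (e' y)) (y := e' y)
          have h3 := hd (e' y)
          linarith
        · have h1 := hF (j + 1) (by omega) (by omega)
          rwa [Function.iterate_succ_apply, heq] at h1

/-- The backward iterates of two close maps are close. -/
theorem dist_symm_iterate_symm_iterate_le (hb : InverseBounds e W L κ) {δ : ℝ}
    (hδ : ∀ x, dist (e' x) (e x) ≤ δ) (k : ℕ) (u : E) :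
    dist (e.symm^[k] u) (e'.symm^[k] u) ≤ (∑ i ∈ Finset.range k, L ^ (i + 1)) * δ := by
  induction k with
  | zero => simp
  | succ k ih =>
    rw [Function.iterate_succ_apply', Function.iterate_succ_apply']
    have h1 := hb.dist_symm_le (e.symm^[k] u) (e (e'.symm (e'.symm^[k] u)))
    rw [e.symm_apply_apply] at h1
    have h2 := hδ (e'.symm (e'.symm^[k] u))
    rw [e'.apply_symm_apply] at h2
    have h3 := dist_triangle (e.symm^[k] u) (e'.symm^[k] u) (e (e'.symm (e'.symm^[k] u)))
    have h4 : dist (e.symm^[k] u) (e (e'.symm (e'.symm^[k] u))) ≤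
        (∑ i ∈ Finset.range k, L ^ (i + 1)) * δ + δ := by linarith
    refine h1.trans ((mul_le_mul_of_nonneg_left h4 hb.nonneg).trans_eq ?_)
    rw [Finset.sum_range_succ', mul_add, ← mul_assoc, Finset.mul_sum, add_mul]
    congr 1
    · congr 1
      exact Finset.sum_congr rfl fun i _ => by ring
    · ring

end InverseBounds

open MeasureTheory in
/-- The images of an open set under the iterates of a volume expanding homeomorphism have unbounded
diameters. -/
theorem exists_le_dist_iterate_of_volume_expanding [FiniteDimensional ℝ E] [MeasurableSpace E]
    [BorelSpace E] {e : E ≃ₜ E} {D : E → E →L[ℝ] E} (hD : ∀ x, HasFDerivAt e (D x) x) {σ : ℝ}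
    (hσ : 1 < σ) (hdet : ∀ x, σ ≤ |(D x).det|) {V : Set E} (hV : IsOpen V) (hne : V.Nonempty)
    (R : ℝ) : ∃ k, ∃ x ∈ V, ∃ y ∈ V, R ≤ dist (e^[k] x) (e^[k] y) := by
  by_contra! hcon
  let μ : Measure E := Measure.addHaar
  have hstep : ∀ S : Set E, MeasurableSet S → ENNReal.ofReal σ * μ S ≤ μ (e '' S) := by
    intro S hS
    rw [← lintegral_abs_det_fderiv_eq_addHaar_image μ hS
      (fun x _ => (hD x).hasFDerivWithinAt) e.injective.injOn, ← setLIntegral_const]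
    exact lintegral_mono fun x => ENNReal.ofReal_le_ofReal (hdet x)
  have hgrow : ∀ k : ℕ, IsOpen (e^[k] '' V) ∧ ENNReal.ofReal σ ^ k * μ V ≤ μ (e^[k] '' V) := by
    intro k
    induction k with
    | zero => simpa using hV
    | succ k ih =>
      rw [Function.iterate_succ', image_comp, pow_succ', mul_assoc]
      exact ⟨e.isOpenMap _ ih.1, (mul_le_mul_right ih.2 _).trans (hstep _ ih.1.measurableSet)⟩
  obtain ⟨x, hx⟩ := hne
  -- Bounded diameters would confine each image to a ball of radius `R`, whose volume does not
  -- depend on the centre, against the exponential growth of volume.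
  have hbound : ∀ k, ENNReal.ofReal σ ^ k * μ V ≤ μ (Metric.ball 0 R) := by
    intro k
    refine (hgrow k).2.trans ?_
    rw [← Measure.addHaar_ball_center μ (e^[k] x) R]
    refine measure_mono ?_
    rintro _ ⟨y, hy, rfl⟩
    exact hcon k y hy x hx
  have hμV : μ V ≠ 0 := (hV.measure_pos μ ⟨x, hx⟩).ne'
  have htend : Tendsto (fun k : ℕ => ENNReal.ofReal σ ^ k * μ V) atTop (𝓝 ⊤) := by
    have h1 : Tendsto (fun k : ℕ => ENNReal.ofReal σ ^ k) atTop (𝓝 ⊤) :=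
      ENNReal.tendsto_pow_atTop_nhds_top_iff.2 (by simpa using hσ)
    have h2 := ENNReal.Tendsto.mul_const h1 (Or.inl ENNReal.top_ne_zero) (b := μ V)
    rwa [ENNReal.top_mul hμV] at h2
  exact (le_of_tendsto' htend hbound).not_gt measure_ball_lt_top

end Dynamics

/-! ### Injective paths -/

section Arcs

/-- `x` and `y` are joined by an injective path in `O`, or equal. -/
def ArcJoined {E : Type*} [TopologicalSpace E] (O : Set E) (x y : E) : Prop :=
  ∃ (α : ℝ → E) (b : ℝ), 0 ≤ b ∧ ContinuousOn α (Icc 0 b) ∧ InjOn α (Icc 0 b) ∧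
    MapsTo α (Icc 0 b) O ∧ α 0 = x ∧ α b = y

theorem ArcJoined.refl {E : Type*} [TopologicalSpace E] {O : Set E} {x : E} (hx : x ∈ O) : ArcJoined O x x :=
  ⟨fun _ => x, 0, le_rfl, continuousOn_const, by simp, fun _ _ => hx, rfl, rfl⟩

variable {E : Type*} [NormedAddCommGroup E] [NormedSpace ℝ E]

/-- An injective path which reaches a convex closed set can be continued inside it. -/
theorem ArcJoined.extend {O C : Set E} {x y z : E} (h : ArcJoined O x y) (hC : IsClosed C)
    (hconv : Convex ℝ C) (hCO : C ⊆ O) (hy : y ∈ C) (hz : z ∈ C) : ArcJoined O x z := by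
  obtain ⟨α, b, hb, hc, hi, hm, rfl, rfl⟩ := h
  have hcomp : IsCompact (Icc 0 b ∩ α ⁻¹' C) :=
    isCompact_Icc.of_isClosed_subset (hc.preimage_isClosed_of_isClosed isClosed_Icc hC)
      inter_subset_left
  -- The path is cut at its first entry into `C` and continued by a segment inside `C`, which cannot
  -- meet the earlier part.
  obtain ⟨t₀, ⟨ht₀, ht₀C⟩, hleast⟩ := hcomp.exists_isLeast ⟨b, ⟨hb, le_rfl⟩, hy⟩
  have hsub : Icc 0 t₀ ⊆ Icc 0 b := Icc_subset_Icc_right ht₀.2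
  have hout : ∀ t, 0 ≤ t → t < t₀ → α t ∉ C := fun t h0 ht hC' =>
    (hleast ⟨⟨h0, ht.le.trans ht₀.2⟩, hC'⟩).not_gt ht
  by_cases hzt : z = α t₀
  · exact ⟨α, t₀, ht₀.1, hc.mono hsub, hi.mono hsub, fun t ht => hm (hsub ht), rfl, hzt.symm⟩
  let β : ℝ → E := fun t => if t ≤ t₀ then α t else α t₀ + (t - t₀) • (z - α t₀)
  have hβ1 : EqOn β α (Icc 0 t₀) := fun t ht => if_pos ht.2
  have hβ2 : EqOn β (fun t => α t₀ + (t - t₀) • (z - α t₀)) (Icc t₀ (t₀ + 1)) := by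
    intro t ht
    by_cases h : t ≤ t₀
    · obtain rfl : t = t₀ := le_antisymm h ht.1
      simp [β]
    · simp [β, h]
  have hβC : ∀ t ∈ Icc t₀ (t₀ + 1), β t ∈ C := by
    intro t ht
    rw [hβ2 ht]
    exact hconv.add_smul_sub_mem ht₀C hz ⟨by linarith [ht.1], by linarith [ht.2]⟩
  have hinj2 : InjOn β (Icc t₀ (t₀ + 1)) := by
    intro s hs t ht hst
    rw [hβ2 hs, hβ2 ht] at hst
    have := smul_left_injective ℝ (sub_ne_zero.2 hzt) (add_left_cancel hst)
    linarith
  have hlt : ∀ s t, s ∈ Icc 0 (t₀ + 1) → t ∈ Icc 0 (t₀ + 1) → s < t₀ → β s = β t → s = t := by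
    intro s t hs ht hst h
    by_cases htt : t < t₀
    · rw [hβ1 ⟨hs.1, hst.le⟩, hβ1 ⟨ht.1, htt.le⟩] at h
      exact hi (hsub ⟨hs.1, hst.le⟩) (hsub ⟨ht.1, htt.le⟩) h
    · have h1 := hβC t ⟨not_lt.1 htt, ht.2⟩
      rw [← h, hβ1 ⟨hs.1, hst.le⟩] at h1
      exact absurd h1 (hout s hs.1 hst)
  refine ⟨β, t₀ + 1, by linarith [ht₀.1], ?_, ?_, ?_, hβ1 ⟨le_rfl, ht₀.1⟩, ?_⟩
  · rw [← Icc_union_Icc_eq_Icc ht₀.1 (by linarith : t₀ ≤ t₀ + 1)]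
    refine ContinuousOn.union_of_isClosed ((hc.mono hsub).congr hβ1)
      (ContinuousOn.congr (by fun_prop) hβ2) isClosed_Icc isClosed_Icc
  · intro s hs t ht hst
    by_cases h1 : s < t₀
    · exact hlt s t hs ht h1 hst
    by_cases h2 : t < t₀
    · exact (hlt t s ht hs h2 hst.symm).symm
    exact hinj2 ⟨not_lt.1 h1, hs.2⟩ ⟨not_lt.1 h2, ht.2⟩ hst
  · intro t ht
    by_cases h : t ≤ t₀
    · rw [hβ1 ⟨ht.1, h⟩]; exact hm (hsub ⟨ht.1, h⟩)
    · exact hCO (hβC t ⟨(not_le.1 h).le, ht.2⟩)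
  · rw [hβ2 ⟨by linarith, le_rfl⟩]; simp

/-- Two points of a connected subset of an open set `O` are joined by an injective path in `O`. -/
theorem IsPreconnected.arcJoined {O K : Set E} (hK : IsPreconnected K) (hO : IsOpen O)
    (hKO : K ⊆ O) {x y : E} (hx : x ∈ K) (hy : y ∈ K) : ArcJoined O x y := by
  have hball : ∀ z ∈ O, ∃ R > 0, Metric.closedBall z R ⊆ O := fun z hz =>
    Metric.nhds_basis_closedBall.mem_iff.1 (hO.mem_nhds hz)
  have hmem : ∀ z, ArcJoined O x z → z ∈ O := by
    rintro z ⟨α, b, hb, -, -, hm, -, rfl⟩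
    exact hm ⟨hb, le_rfl⟩
  -- The set of points reachable from `x` is open, and closed relative to `K`; both follow by
  -- extending arcs inside small closed balls.
  refine hK.subset_of_closure_inter_subset (u := {z | ArcJoined O x z}) ?_
    ⟨x, hx, ArcJoined.refl (hKO hx)⟩ ?_ hy
  · refine Metric.isOpen_iff.2 fun z hz => ?_
    obtain ⟨R, hR, hRO⟩ := hball z (hmem z hz)
    refine ⟨R, hR, fun w hw => ?_⟩
    exact ArcJoined.extend hz Metric.isClosed_closedBall (convex_closedBall z R) hRO
      (Metric.mem_closedBall_self hR.le) (Metric.ball_subset_closedBall hw)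
  · rintro z ⟨hz, hzK⟩
    obtain ⟨R, hR, hRO⟩ := hball z (hKO hzK)
    obtain ⟨w, hw, hzw⟩ := Metric.mem_closure_iff.1 hz R hR
    exact ArcJoined.extend hw Metric.isClosed_closedBall (convex_closedBall z R) hRO
      (by rw [Metric.mem_closedBall, dist_comm]; exact hzw.le) (Metric.mem_closedBall_self hR.le)

end Arcs

/-! ### The maximum distance -/

section SupDist

variable {n : ℕ}

/-- The distance `max |xᵢ - yᵢ|` as a real number. -/
noncomputable def supDist (x y : Cover n) : ℝ := dist (WithLp.ofLp x) (WithLp.ofLp y)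

theorem supEDist_eq (x y : Cover n) : supEDist x y = ENNReal.ofReal (supDist x y) := by
  rw [supDist, ← edist_dist, edist_pi_def, Finset.sup_univ_eq_iSup, supEDist]
  simp [edist_dist, Real.dist_eq]

theorem abs_sub_le_supDist (x y : Cover n) (i : Fin n) : |x i - y i| ≤ supDist x y :=
  dist_le_pi_dist (WithLp.ofLp x) (WithLp.ofLp y) i

theorem supDist_le_dist (x y : Cover n) : supDist x y ≤ dist x y :=
  (dist_pi_le_iff dist_nonneg).2 fun i => abs_apply_sub_le_dist x y i

theorem dist_le_mul_supDist (x y : Cover n) : dist x y ≤ n * supDist x y := by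
  rw [dist_eq_norm]
  exact Cover.norm_le_of_forall_abs_le dist_nonneg fun i => abs_sub_le_supDist x y i

theorem supDist_triangle (x y z : Cover n) : supDist x z ≤ supDist x y + supDist y z :=
  dist_triangle _ _ _

theorem supDist_comm (x y : Cover n) : supDist x y = supDist y x := dist_comm _ _

theorem supDist_add_right (x y z : Cover n) : supDist (x + z) (y + z) = supDist x y :=
  dist_add_right _ _ _

theorem ContinuousOn.supDist {X : Type*} [TopologicalSpace X] {f g : X → Cover n} {s : Set X}
    (hf : ContinuousOn f s) (hg : ContinuousOn g s) :
    ContinuousOn (fun x => _root_.supDist (f x) (g x)) s := by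
  have h := PiLp.continuous_ofLp 2 fun _ : Fin n => ℝ
  exact continuous_dist.comp_continuousOn ((h.comp_continuousOn hf).prodMk (h.comp_continuousOn hg))

theorem one_le_supDist_of_proj_eq {x y : Cover n} (h : proj x = proj y) (hne : x ≠ y) :
    1 ≤ supDist x y := by
  obtain ⟨k, rfl⟩ := proj_eq_proj_iff.1 h
  have hk : k ≠ 0 := by
    rintro rfl
    apply hne
    ext i; simp
  obtain ⟨i, hi⟩ := one_le_abs_of_ne hk
  refine hi.trans (le_trans (le_of_eq ?_) (abs_sub_le_supDist _ _ i))
  simp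

/-- A path with end points at distance more than `δ < 1` contains a minimal piece with end points
at distance at least `c`, where `δ < c < 1`. -/
theorem exists_minimal_subpath {α : ℝ → Cover n} {b : ℝ} (hb : 0 ≤ b)
    (hc : ContinuousOn α (Icc 0 b)) {c : ℝ} (hcpq : c ≤ supDist (α 0) (α b)) :
    ∃ s t, 0 ≤ s ∧ s ≤ t ∧ t ≤ b ∧ c ≤ supDist (α s) (α t) ∧
      ∀ u v, s ≤ u → u ≤ v → v ≤ t → c ≤ supDist (α u) (α v) → u = s ∧ v = t := by
  have hdc : ContinuousOn (fun z : ℝ × ℝ => supDist (α z.1) (α z.2)) (Icc 0 b ×ˢ Icc 0 b) :=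
    (hc.comp continuousOn_fst fun z hz => hz.1).supDist
      (hc.comp continuousOn_snd fun z hz => hz.2)
  have hclosed : IsClosed ((Icc 0 b ×ˢ Icc 0 b) ∩
      (fun z : ℝ × ℝ => supDist (α z.1) (α z.2)) ⁻¹' Ici c) :=
    hdc.preimage_isClosed_of_isClosed (isClosed_Icc.prod isClosed_Icc) isClosed_Ici
  have hP : IsCompact (((Icc 0 b ×ˢ Icc 0 b) ∩
      (fun z : ℝ × ℝ => supDist (α z.1) (α z.2)) ⁻¹' Ici c) ∩ {z : ℝ × ℝ | z.1 ≤ z.2}) :=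
    ((isCompact_Icc.prod isCompact_Icc).of_isClosed_subset hclosed inter_subset_left).inter_right
      (isClosed_le continuous_fst continuous_snd)
  -- The pair minimizes the time length `t - s` over the compact set of ordered pairs of times whose
  -- points are at least `c` apart.
  obtain ⟨⟨s, t⟩, ⟨⟨⟨hs, ht⟩, hdst⟩, hst⟩, hmin⟩ := hP.exists_isMinOn
    ⟨(0, b), ⟨⟨⟨le_rfl, hb⟩, hb, le_rfl⟩, hcpq⟩, hb⟩ (f := fun z : ℝ × ℝ => z.2 - z.1)
      (by fun_prop)
  replace hs : 0 ≤ s ∧ s ≤ b := hs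
  replace ht : 0 ≤ t ∧ t ≤ b := ht
  replace hdst : c ≤ supDist (α s) (α t) := hdst
  replace hst : 0 ≤ t - s := sub_nonneg.2 hst
  refine ⟨s, t, hs.1, sub_nonneg.1 hst, ht.2, hdst, fun u v hu huv hv hd => ?_⟩
  have : t - s ≤ v - u := hmin (a := (u, v)) ⟨⟨⟨⟨hs.1.trans hu, (huv.trans hv).trans ht.2⟩,
      (hs.1.trans hu).trans huv, hv.trans ht.2⟩, hd⟩, huv⟩
  constructor <;> linarith

/-- An injective path of `ℝⁿ` with end points at distance more than `δ < 1` contains a lift of an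
arc of the torus of diameter more than `δ`. -/
theorem ArcJoined.exists_isArcLift {O : Set (Cover n)} {p q : Cover n} (h : ArcJoined O p q)
    {δ : ℝ} (hδ0 : 0 ≤ δ) (hδ1 : δ < 1) (hpq : δ < supDist p q) :
    ∃ γ : C(unitInterval, Cover n), IsArcLift γ ∧ (∀ t, γ t ∈ O) ∧
      ENNReal.ofReal δ < supDiam (range γ) := by
  obtain ⟨α, b, hb, hc, hi, hm, rfl, rfl⟩ := h
  -- Distinct points with equal projection are at least `1 > c` apart, so on a minimal piece for `c`
  -- they could only be its two end points.
  obtain ⟨c, hδc, hc1⟩ := exists_between (lt_min hδ1 hpq)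
  obtain ⟨s, t, hs0, hst', htb, hdst, hmin'⟩ :=
    exists_minimal_subpath hb hc (hc1.trans_le (min_le_right _ _)).le
  have hst : 0 ≤ t - s := sub_nonneg.2 hst'
  have hlt : s < t := by
    refine lt_of_le_of_ne (by linarith) ?_
    rintro rfl
    have : supDist (α s) (α s) = 0 := dist_self _
    linarith
  -- This excludes the end points too: at distance at least `1 > c`, a slightly later start would
  -- still give distance more than `c`, against minimality.
  have hle : supDist (α s) (α t) < 1 := by
    by_contra! hge
    have hcs : ContinuousWithinAt (fun u => supDist (α u) (α t)) (Ioc s t) s := by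
      have h1 : ContinuousOn (fun u => supDist (α u) (α t)) (Icc 0 b) :=
        hc.supDist continuousOn_const
      exact (h1 s ⟨hs0, hst'.trans htb⟩).mono fun u hu =>
        ⟨hs0.trans hu.1.le, hu.2.trans htb⟩
    have hc1' : c < supDist (α s) (α t) := (hc1.trans_le (min_le_left _ _)).trans_le hge
    have : (𝓝[Ioc s t] s).NeBot := by
      rw [← mem_closure_iff_nhdsWithin_neBot, closure_Ioc hlt.ne]
      exact ⟨le_rfl, hlt.le⟩
    obtain ⟨u, hu, hu'⟩ := ((hcs.eventually_const_lt hc1').and self_mem_nhdsWithin).exists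
    exact hu'.1.ne' (hmin' u t hu'.1.le hu'.2 le_rfl hu.le).1
  have hmaps : ∀ u : unitInterval, s + u * (t - s) ∈ Icc 0 b := fun u => by
    have h1 := u.2.1
    have h2 := u.2.2
    have h3 : (u : ℝ) * (t - s) ≤ 1 * (t - s) := mul_le_mul_of_nonneg_right h2 hst
    have h4 : 0 ≤ (u : ℝ) * (t - s) := mul_nonneg h1 hst
    exact ⟨by linarith, by linarith⟩
  let γ : C(unitInterval, Cover n) := ⟨fun u => α (s + u * (t - s)),
    hc.comp_continuous (by fun_prop) hmaps⟩
  have hγ : ∀ u, γ u = α (s + u * (t - s)) := fun _ => rfl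
  have hinj : ∀ u v : unitInterval, u < v → proj (γ u) ≠ proj (γ v) := by
    intro u v huv h
    have huv' : (u : ℝ) < v := huv
    have h3 : (u : ℝ) * (t - s) < v * (t - s) := mul_lt_mul_of_pos_right huv' (by linarith)
    have hne : γ u ≠ γ v := fun h' => h3.ne (by
      have := hi (hmaps u) (hmaps v) h'
      linarith)
    have h1 := one_le_supDist_of_proj_eq h hne
    have h4 : (v : ℝ) * (t - s) ≤ 1 * (t - s) := mul_le_mul_of_nonneg_right v.2.2 hst
    have h5 : 0 ≤ (u : ℝ) * (t - s) := mul_nonneg u.2.1 hst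
    obtain ⟨h6, h7⟩ := hmin' (s + u * (t - s)) (s + v * (t - s)) (by linarith) (by linarith)
      (by linarith) (((hc1.trans_le (min_le_left _ _)).le).trans h1)
    rw [hγ, hγ, h6, h7] at h1
    linarith
  refine ⟨γ, fun u v huv => ?_, fun u => hm (hmaps u), ?_⟩
  · rcases lt_trichotomy u v with h | h | h
    · exact absurd huv (hinj u v h)
    · exact h
    · exact absurd huv.symm (hinj v u h)
  · have h0 : γ 0 = α s := by rw [hγ]; simp
    have h1 : γ 1 = α t := by rw [hγ]; simp
    refine lt_of_lt_of_le ?_ (le_iSup₂_of_le (γ 0) (mem_range_self 0)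
      (le_iSup₂_of_le (γ 1) (mem_range_self 1) le_rfl))
    rw [supEDist_eq, h0, h1]
    exact (ENNReal.ofReal_lt_ofReal_iff (by linarith)).2 (by linarith)

end SupDist

/-! ### Paths crossing the complement of the lifts of a small set -/

theorem exists_last_time {u : ℝ → ℝ} {a b s : ℝ} (hab : a ≤ b) (hu : ContinuousOn u (Icc a b))
    (ha : u a ≤ s) (hb : s ≤ u b) : ∃ t ∈ Icc a b, u t = s ∧ ∀ x ∈ Icc t b, s ≤ u x := by
  obtain ⟨t₀, ht₀, hut₀⟩ := intermediate_value_Icc hab hu ⟨ha, hb⟩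
  have hcomp : IsCompact (Icc a b ∩ u ⁻¹' {s}) :=
    isCompact_Icc.of_isClosed_subset
      (hu.preimage_isClosed_of_isClosed isClosed_Icc isClosed_singleton) inter_subset_left
  obtain ⟨t, ⟨ht, hut⟩, hgr⟩ := hcomp.exists_isGreatest ⟨t₀, ht₀, hut₀⟩
  refine ⟨t, ht, hut, fun x hx => ?_⟩
  by_contra! hlt
  obtain ⟨y, hy, huy⟩ := intermediate_value_Icc hx.2
    (hu.mono (Icc_subset_Icc_left (ht.1.trans hx.1))) ⟨hlt.le, hb⟩
  have hyt : y ≤ t := hgr ⟨⟨ht.1.trans (hx.1.trans hy.1), hy.2⟩, huy⟩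
  obtain rfl : x = t := le_antisymm (hy.1.trans hyt) hx.1
  exact hlt.ne hut

theorem exists_first_time {u : ℝ → ℝ} {a b s : ℝ} (hab : a ≤ b) (hu : ContinuousOn u (Icc a b))
    (ha : s ≤ u a) (hb : u b ≤ s) : ∃ t ∈ Icc a b, u t = s ∧ ∀ x ∈ Icc a t, s ≤ u x := by
  have hneg : ContinuousOn (fun x => u (-x)) (Icc (-b) (-a)) :=
    hu.comp (by fun_prop) fun x hx => ⟨by linarith [hx.2], by linarith [hx.1]⟩
  obtain ⟨t, ht, hut, h⟩ := exists_last_time (neg_le_neg hab) hneg (by simpa using hb)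
    (by simpa using ha)
  refine ⟨-t, ⟨by linarith [ht.2], by linarith [ht.1]⟩, hut, fun x hx => ?_⟩
  simpa using h (-x) ⟨by linarith [hx.2], by linarith [hx.1]⟩

/-- A path which goes far from `A` contains a piece which leaves `A` and either reaches `A'` or
ends far from `A`. -/
theorem exists_crossing {X : Type*} [PseudoMetricSpace X] {φ : ℝ → X} {a b s D : ℝ} (hab : a ≤ b)
    (hφ : ContinuousOn φ (Icc a b)) {A A' : Set X} (hA : A.Nonempty) (hsD : 2 * s ≤ D)
    (hAA' : ∀ x ∈ A, ∀ y ∈ A', D ≤ dist x y) (ha : Metric.infDist (φ a) A ≤ s)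
    (hb : D - s ≤ Metric.infDist (φ b) A) :
    ∃ t₁ t₂, a ≤ t₁ ∧ t₁ ≤ t₂ ∧ t₂ ≤ b ∧
      (∀ t ∈ Icc t₁ t₂, ∀ x ∈ A ∪ A', s ≤ dist (φ t) x) ∧ D - 2 * s ≤ dist (φ t₁) (φ t₂) := by
  have hcA : ContinuousOn (fun t => Metric.infDist (φ t) A) (Icc a b) :=
    (Metric.continuous_infDist_pt A).comp_continuousOn hφ
  have hcA' : ContinuousOn (fun t => Metric.infDist (φ t) A') (Icc a b) :=
    (Metric.continuous_infDist_pt A').comp_continuousOn hφ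
  -- Being at distance `s` from one set thus forces distance at least `D - s` from the other. The
  -- piece runs from the last time at distance `s` from `A` to the first later time at distance `s`
  -- from `A'`, or to the end if `A'` is never approached.
  have hsum : A'.Nonempty → ∀ z, D ≤ Metric.infDist z A + Metric.infDist z A' := by
    intro hne z
    rw [← sub_le_iff_le_add', Metric.le_infDist hne]
    intro y hy
    rw [sub_le_comm, Metric.le_infDist hA]
    intro x hx
    linarith [hAA' x hx y hy, dist_triangle_left x y z]
  obtain ⟨t₁, ht₁, hut₁, hlast⟩ := exists_last_time hab hcA ha (by linarith)
  have hfarA : ∀ t ∈ Icc t₁ b, ∀ x ∈ A, s ≤ dist (φ t) x := fun t ht x hx =>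
    (hlast t ht).trans (Metric.infDist_le_dist_of_mem hx)
  by_cases h : ∃ t ∈ Icc t₁ b, ∃ y ∈ A', dist (φ t) y < s
  · obtain ⟨t, ht, y, hy, hty⟩ := h
    have h1 := hsum ⟨y, hy⟩ (φ t₁)
    obtain ⟨t₂, ht₂, hut₂, hfirst⟩ := exists_first_time (s := s) ht.1
      (hcA'.mono (Icc_subset_Icc ht₁.1 ht.2)) (by linarith)
      ((Metric.infDist_le_dist_of_mem hy).trans hty.le)
    refine ⟨t₁, t₂, ht₁.1, ht₂.1, ht₂.2.trans ht.2, fun x hx z hz => ?_, ?_⟩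
    · rcases hz with hz | hz
      · exact hfarA x ⟨hx.1, hx.2.trans (ht₂.2.trans ht.2)⟩ z hz
      · exact (hfirst x hx).trans (Metric.infDist_le_dist_of_mem hz)
    · have h2 := hsum ⟨y, hy⟩ (φ t₂)
      have h3 := Metric.infDist_le_infDist_add_dist (s := A) (x := φ t₂) (y := φ t₁)
      rw [dist_comm] at h3
      linarith
  · push Not at h
    refine ⟨t₁, b, ht₁.1, ht₁.2, le_rfl, fun x hx z hz => ?_, ?_⟩
    · rcases hz with hz | hz
      · exact hfarA x hx z hz
      · exact h x hx z hz
    · have h3 := Metric.infDist_le_infDist_add_dist (s := A) (x := φ b) (y := φ t₁)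
      rw [dist_comm] at h3
      linarith

section Frame

variable {n : ℕ} {a : Cover n} {U : Set (Torus n)} {D s : ℝ}

/-- The lift of `U` is the union of the translates of its part in the fundamental domain. -/
theorem exists_mem_frameLift {w : Cover n} (hw : proj w ∈ U) :
    ∃ k : Fin n → ℤ, ∃ x ∈ frameLift a U, w = x + intVec k := by
  obtain ⟨y, hy, hy'⟩ := exists_proj_eq_mem_box a (proj w)
  obtain ⟨k, hk⟩ := proj_eq_proj_iff.1 hy
  exact ⟨k, y, ⟨hy', hy ▸ hw⟩, hk⟩

/-- The lift of `U` is split into the translate of `Ũ` near `γ t₀` and the union of all the others,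
which lie at distance at least `D` from it. Since each translate has diameter at most 1, the end
point `q` is at least `4 - s - 1 ≥ D - s` from the first, and `exists_crossing` applies. -/
theorem exists_crossing_of_path (hdiam : ∀ x ∈ frameLift a U, ∀ y ∈ frameLift a U, supDist x y ≤ 1)
    (hsep : ∀ k : Fin n → ℤ, k ≠ 0 → ∀ x ∈ frameLift a U, ∀ y ∈ frameLift a U,
      D ≤ supDist x (y + intVec k)) (hD : D ≤ 1) (hsD : 2 * s ≤ D)
    {p q : Cover n} (γ : Path p q) {t₀ : unitInterval} {w : Cover n} (hw : proj w ∈ U)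
    (hwt : supDist (γ t₀) w ≤ s) (hq : 4 ≤ supDist (γ t₀) q) :
    ∃ K ⊆ range γ, IsCompact K ∧ IsPreconnected K ∧
      (∀ y ∈ K, ∀ w, proj w ∈ U → s ≤ supDist y w) ∧
      ∃ p' ∈ K, ∃ q' ∈ K, D - 2 * s ≤ supDist p' q' := by
  obtain ⟨k, x₀, hx₀, rfl⟩ := exists_mem_frameLift (a := a) hw
  let C : (Fin n → ℤ) → Set (Fin n → ℝ) := fun j =>
    (fun x : Cover n => WithLp.ofLp (x + intVec j)) '' frameLift a U
  have hsepC : ∀ x ∈ C k, ∀ y ∈ ⋃ j ≠ k, C j, D ≤ dist x y := by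
    rintro _ ⟨x, hx, rfl⟩ y hy
    simp only [mem_iUnion] at hy
    obtain ⟨j, hjk, y, hy, rfl⟩ := hy
    have h1 := hsep (j - k) (sub_ne_zero.2 hjk) x hx y hy
    rw [← supDist_add_right _ _ (intVec k)] at h1
    have h2 : y + intVec (j - k) + intVec k = y + intVec j := by
      ext i; simp; ring
    rw [h2] at h1
    exact h1
  have hx₀C : WithLp.ofLp (x₀ + intVec k) ∈ C k := mem_image_of_mem _ hx₀
  have hc : Continuous fun t => WithLp.ofLp (γ.extend t) :=
    (PiLp.continuous_ofLp 2 _).comp γ.continuous_extend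
  have hfar : D - s ≤ Metric.infDist (WithLp.ofLp (γ.extend 1)) (C k) := by
    rw [Metric.le_infDist ⟨_, hx₀C⟩]
    rintro _ ⟨x, hx, rfl⟩
    have h1 := hdiam x₀ hx₀ x hx
    rw [← supDist_add_right _ _ (intVec k)] at h1
    have h2 := supDist_triangle (γ t₀) (x₀ + intVec k) q
    have h3 := supDist_triangle (x₀ + intVec k) (x + intVec k) q
    have h4 : D - s ≤ supDist q (x + intVec k) := by
      rw [supDist_comm q]; linarith
    rw [γ.extend_one]
    exact h4
  have hnear : Metric.infDist (WithLp.ofLp (γ.extend t₀)) (C k) ≤ s := by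
    rw [γ.extend_apply t₀.2]
    exact (Metric.infDist_le_dist_of_mem hx₀C).trans hwt
  obtain ⟨t₁, t₂, h01, h12, h21, havoid, hdist⟩ := exists_crossing t₀.2.2 hc.continuousOn
    ⟨_, hx₀C⟩ hsD hsepC hnear hfar
  refine ⟨γ.extend '' Icc t₁ t₂, ?_, isCompact_Icc.image γ.continuous_extend,
    isPreconnected_Icc.image _ γ.continuous_extend.continuousOn, ?_,
    _, mem_image_of_mem _ (left_mem_Icc.2 h12), _, mem_image_of_mem _ (right_mem_Icc.2 h12), hdist⟩
  · rintro _ ⟨t, -, rfl⟩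
    rw [← γ.extend_range]
    exact mem_range_self t
  · rintro _ ⟨t, ht, rfl⟩ w hw
    obtain ⟨j, x, hx, rfl⟩ := exists_mem_frameLift (a := a) hw
    refine havoid t ht _ ?_
    by_cases hjk : j = k
    · subst hjk
      exact Or.inl (mem_image_of_mem _ hx)
    · exact Or.inr (mem_biUnion (x := j) hjk (mem_image_of_mem _ hx))

/-- A path connected set of large diameter contains a connected compact set far from the lift of
`U`, of diameter almost the internal diameter. -/
theorem exists_isCompact_isPreconnected_far
    (hdiam : ∀ x ∈ frameLift a U, ∀ y ∈ frameLift a U, supDist x y ≤ 1)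
    (hsep : ∀ k : Fin n → ℤ, k ≠ 0 → ∀ x ∈ frameLift a U, ∀ y ∈ frameLift a U,
      D ≤ supDist x (y + intVec k)) (hD : D ≤ 1) (hs : 0 ≤ s) (hsD : 2 * s ≤ D)
    {O : Set (Cover n)} (hO : IsPathConnected O) {p q : Cover n} (hp : p ∈ O) (hq : q ∈ O)
    (hpq : 8 ≤ supDist p q) :
    ∃ K ⊆ O, IsCompact K ∧ IsPreconnected K ∧
      (∀ y ∈ K, ∀ w, proj w ∈ U → s ≤ supDist y w) ∧
      ∃ p' ∈ K, ∃ q' ∈ K, D - 2 * s ≤ supDist p' q' := by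
  obtain ⟨γ, hγ⟩ := hO.joinedIn p hp q hq
  by_cases h : ∃ t, ∃ w, proj w ∈ U ∧ supDist (γ t) w ≤ s
  · obtain ⟨t, w, hw, hwt⟩ := h
    -- Since `p` and `q` are at least 8 apart, one of them is at least 4 from `γ t`; the path is
    -- reversed if it is `p`.
    by_cases h4 : 4 ≤ supDist (γ t) q
    · obtain ⟨K, hK, h⟩ := exists_crossing_of_path hdiam hsep hD hsD γ hw hwt h4
      exact ⟨K, hK.trans (range_subset_iff.2 hγ), h⟩
    · have h4' : 4 ≤ supDist (γ t) p := by
        have := supDist_triangle p (γ t) q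
        rw [supDist_comm p (γ t)] at this
        linarith
      obtain ⟨K, hK, h⟩ := exists_crossing_of_path hdiam hsep hD hsD γ.symm
        (t₀ := unitInterval.symm t) hw (by simpa using hwt) (by simpa using h4')
      refine ⟨K, hK.trans ?_, h⟩
      rw [Path.symm_range]
      exact range_subset_iff.2 hγ
  · push Not at h
    refine ⟨range γ, range_subset_iff.2 hγ, isCompact_range γ.continuous,
      isPreconnected_range γ.continuous, ?_, p, ⟨0, γ.source⟩, q, ⟨1, γ.target⟩, by linarith⟩
    rintro _ ⟨t, rfl⟩ w hw
    exact (h t w hw).le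

end Frame

namespace TorusEndo

variable {n : ℕ} {r : ℕ∞}

/-! ### Dense pre-orbits -/

/-- If all pre-orbits are dense then some forward orbit is dense. -/
theorem transitive_of_dense_preorbit (g : TorusEndo n r) (h : ∀ x, Dense (g.preorbit x)) :
    g.Transitive := by
  let B := TopologicalSpace.countableBasis (Torus n)
  -- Baire: the points whose orbit visits `V` form an open set, dense because it contains the
  -- pre-orbit of any point of `V`.
  have hd : Dense (⋂ V ∈ B, ⋃ k : ℕ, g^[k] ⁻¹' V) := by
    refine dense_biInter_of_isOpen (fun V hV => isOpen_iUnion fun k => ?_)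
      (TopologicalSpace.countable_countableBasis _) fun V hV => ?_
    · exact (TopologicalSpace.isOpen_of_mem_countableBasis hV).preimage (g.continuous.iterate k)
    · obtain ⟨x, hx⟩ := TopologicalSpace.nonempty_of_mem_countableBasis hV
      refine (h x).mono ?_
      rintro w ⟨k, hk⟩
      exact mem_iUnion.2 ⟨k, by rw [mem_preimage, hk]; exact hx⟩
  obtain ⟨x, hx⟩ := hd.nonempty
  refine ⟨x, (TopologicalSpace.isBasis_countableBasis _).dense_iff.2 fun V hV _ => ?_⟩
  obtain ⟨k, hk⟩ := mem_iUnion.1 (mem_iInter₂.1 hx V hV)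
  exact ⟨_, hk, mem_range_self k⟩

/-- If all pre-orbits of an open map are dense, they are uniformly dense in bounded time. -/
theorem exists_uniform_preorbit {f : TorusEndo n r} (hf : IsOpenMap f)
    (hdense : ∀ x, Dense (f.preorbit x)) {ε : ℝ} (hε : 0 < ε) :
    ∃ N, ∀ (z : Cover n) (x : Torus n), ∃ k ≤ N, ∃ w ∈ Metric.ball z ε, f^[k] (proj w) = x := by
  have hball : ∀ z : Cover n, IsOpen (proj '' Metric.ball z (ε / 2)) := fun z =>
    isOpenMap_proj _ Metric.isOpen_ball
  have hN : ∀ z : Cover n, ∃ N, ∀ x, ∃ k ≤ N, ∃ w ∈ Metric.ball z (ε / 2),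
      f^[k] (proj w) = x := by
    intro z
    -- Compactness is used twice: here in the target `x`, for a fixed ball, and below in the centre
    -- `z`, where halving the radius makes finitely many balls suffice.
    obtain ⟨s, hs⟩ := isCompact_univ.elim_finite_subcover
      (fun k : ℕ => f^[k] '' (proj '' Metric.ball z (ε / 2))) (fun k => isOpenMap_iterate hf k _ (hball z))
      (fun x _ => by
        obtain ⟨y, hy, k, hk⟩ := (hdense x).inter_open_nonempty _ (hball z)
          ⟨proj z, mem_image_of_mem _ (Metric.mem_ball_self (half_pos hε))⟩
        exact mem_iUnion.2 ⟨k, y, hy, hk⟩)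
    refine ⟨s.sup id, fun x => ?_⟩
    obtain ⟨k, hk, _, ⟨w, hw, rfl⟩, hx⟩ := mem_iUnion₂.1 (hs (mem_univ x))
    exact ⟨k, Finset.le_sup (f := id) hk, w, hw, hx⟩
  choose N hN using hN
  obtain ⟨s, hs⟩ := isCompact_univ.elim_finite_subcover
    (fun z : Cover n => proj '' Metric.ball z (ε / 2)) hball (fun x _ => by
      obtain ⟨z, rfl⟩ := proj_surjective x
      exact mem_iUnion.2 ⟨z, mem_image_of_mem _ (Metric.mem_ball_self (half_pos hε))⟩)
  refine ⟨s.sup N, fun z x => ?_⟩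
  obtain ⟨z', hz', y, hy, hyz⟩ := mem_iUnion₂.1 (hs (mem_univ (proj z)))
  obtain ⟨k, hk, w, hw, hwx⟩ := hN z' x
  obtain ⟨j, rfl⟩ := proj_eq_proj_iff.1 hyz
  refine ⟨k, hk.trans (Finset.le_sup hz'), w + intVec j, ?_, by rwa [proj_add_intVec]⟩
  rw [Metric.mem_ball, dist_add_right]
  rw [Metric.mem_ball] at hw hy
  linarith [dist_triangle_right w y z']

/-- Uniform density of the pre-orbits, at a given scale, is a robust property. -/
theorem exists_robust_uniform_preorbit {f : TorusEndo n r} (hf : IsOpenMap f)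
    (hdense : ∀ x, Dense (f.preorbit x)) {e : Cover n ≃ₜ Cover n} (he : f.IsLift e)
    {W : Set (Cover n)} {L κ : ℝ} (hb : InverseBounds e W L κ) {ε : ℝ} (hε : 0 < ε) :
    ∃ δ > 0, ∀ (g : TorusEndo n r) (e' : Cover n ≃ₜ Cover n), g.IsLift e' →
      (∀ x, dist (e' x) (e x) ≤ δ) → ∀ (z : Cover n) (x : Torus n),
        ∃ k, ∃ w ∈ Metric.ball z ε, g^[k] (proj w) = x := by
  obtain ⟨N, hN⟩ := exists_uniform_preorbit hf hdense (half_pos hε)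
  let S : ℝ := ∑ i ∈ Finset.range N, L ^ (i + 1)
  have hS : 0 ≤ S := Finset.sum_nonneg fun i _ => pow_nonneg hb.nonneg _
  refine ⟨ε / 2 / (S + 1), by positivity, fun g e' he' hδ z x => ?_⟩
  obtain ⟨k, hk, w, hw, hwx⟩ := hN z x
  -- Going forward with `e` and back with `e'` gives a point with exactly the required image under
  -- `g^[k]`, close to `w` because `k ≤ N`.
  refine ⟨k, e'.symm^[k] (e^[k] w), ?_, ?_⟩
  · have h1 := hb.dist_symm_iterate_symm_iterate_le hδ k (e^[k] w)
    rw [(Function.LeftInverse.iterate e.symm_apply_apply k : Function.LeftInverse _ _) w] at h1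
    have h2 : ∑ i ∈ Finset.range k, L ^ (i + 1) ≤ S :=
      Finset.sum_le_sum_of_subset_of_nonneg (Finset.range_mono hk)
        fun i _ _ => pow_nonneg hb.nonneg _
    have h3 : (∑ i ∈ Finset.range k, L ^ (i + 1)) * (ε / 2 / (S + 1)) ≤ ε / 2 := by
      rw [mul_div_assoc', div_le_iff₀ (by positivity), mul_comm]
      gcongr
      linarith
    rw [dist_comm] at h1
    rw [Metric.mem_ball] at hw ⊢
    linarith [dist_triangle (e'.symm^[k] (e^[k] w)) w z]
  · rw [← he'.iterate, (Function.LeftInverse.iterate e'.apply_symm_apply k :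
      Function.LeftInverse _ _) (e^[k] w), he.iterate, hwx]

/-! ### Robust bounds of the derivative -/

/-- A noninvertible map has `inverse` zero and hence `minNorm` zero, so the strict lower bound
already forces invertibility. -/
theorem le_norm_of_lt_minNorm {A : Cover n →L[ℝ] Cover n} {l : ℝ} (hl : 0 < l)
    (h : l < minNorm A) (v : Cover n) : l * ‖v‖ ≤ ‖A v‖ := by
  have hA : A.IsInvertible := by
    by_contra hcon
    rw [minNorm, ContinuousLinearMap.inverse_of_not_isInvertible hcon, norm_zero, inv_zero] at h
    exact hl.not_gt h
  have h0 : 0 < ‖A.inverse‖ := inv_pos.1 (hl.trans h)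
  have h1 : ‖v‖ ≤ ‖A.inverse‖ * ‖A v‖ := by
    have h2 := A.inverse.le_opNorm (A v)
    rwa [hA.inverse_apply_self] at h2
  calc l * ‖v‖ ≤ ‖A.inverse‖⁻¹ * ‖v‖ := mul_le_mul_of_nonneg_right h.le (norm_nonneg v)
    _ ≤ ‖A v‖ := by rwa [inv_mul_le_iff₀ h0]

/-- The norm of `A v` is positive, hence bounded below, on the compact product of the set of
derivatives and the unit sphere. -/
theorem exists_le_norm_D (f : TorusEndo n r) (hr : 1 ≤ r) (hdet : ∀ x, (f.D x).det ≠ 0) :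
    ∃ c > 0, ∀ x v, c * ‖v‖ ≤ ‖f.D x v‖ := by
  obtain ⟨c, hc, h⟩ := ((f.isCompact_range_D hr).prod
    (isCompact_sphere (0 : Cover n) 1)).exists_forall_le' (a := (0 : ℝ))
    (f := fun p : (Cover n →L[ℝ] Cover n) × Cover n => ‖p.1 p.2‖) (by fun_prop) (by
      rintro ⟨_, v⟩ ⟨⟨x, rfl⟩, hv⟩
      rw [mem_sphere_zero_iff_norm] at hv
      refine norm_pos_iff.2 fun h0 => ?_
      have : v = 0 := ((f.D x).toContinuousLinearEquivOfDetNeZero (hdet x)).map_eq_zero_iff.1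
        (by simpa using h0)
      rw [this, norm_zero] at hv
      exact zero_ne_one hv)
  refine ⟨c, hc, fun x v => ?_⟩
  rcases eq_or_ne v 0 with rfl | hv
  · simp
  have hv' : 0 < ‖v‖ := norm_pos_iff.2 hv
  have h1 := h (f.D x, ‖v‖⁻¹ • v) ⟨mem_range_self x, by simp [norm_smul, hv'.ne']⟩
  simp only [map_smul, norm_smul, norm_inv, norm_norm] at h1
  rwa [← div_eq_inv_mul, le_div_iff₀ hv'] at h1

/-- Volume expansion, invertibility of the derivative and expansion outside `U` are robust, with
uniform constants. -/
theorem exists_eventually_bounds (f : TorusEndo n r) (hr : 1 ≤ r) (hvol : f.VolumeExpanding)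
    {U : Set (Torus n)} (hexp : f.ExpandingOn Uᶜ) :
    ∃ σ > 1, ∃ c > 0, ∃ l > 1, ∀ᶠ g : TorusEndo n r in 𝓝 f,
      (∀ x, σ ≤ |(g.D x).det|) ∧ (∀ x v, c * ‖v‖ ≤ ‖g.D x v‖) ∧
      ∀ x, proj x ∉ U → ∀ v, l * ‖v‖ ≤ ‖g.D x v‖ := by
  obtain ⟨σ, hσ, hdet⟩ := hvol
  obtain ⟨l, hl, hlU⟩ := hexp
  obtain ⟨c, hc, hcD⟩ := f.exists_le_norm_D hr fun x h0 => by
    have := hdet x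
    rw [h0, abs_zero] at this
    linarith
  have hopen : IsOpen {A : Cover n →L[ℝ] Cover n | σ < |A.det|} :=
    isOpen_lt continuous_const ContinuousLinearMap.continuous_det.abs
  obtain ⟨δ, hδ, hthick⟩ := (f.isCompact_range_D hr).exists_thickening_subset_open hopen
    (range_subset_iff.2 hdet)
  have hpert : ∀ {g : TorusEndo n r} {b δ' : ℝ} {x v : Cover n}, b * ‖v‖ ≤ ‖f.D x v‖ →
      ‖f.D x - g.D x‖ ≤ δ' → (b - δ') * ‖v‖ ≤ ‖g.D x v‖ := by
    intro g b δ' x v h1 h2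
    have h3 := (f.D x - g.D x).le_of_opNorm_le h2 v
    have h4 := norm_sub_norm_le (f.D x v) (g.D x v)
    rw [sub_apply] at h3
    rw [sub_mul]
    linarith
  refine ⟨σ, hσ, c / 2, half_pos hc, (1 + l) / 2, by linarith, ?_⟩
  filter_upwards [f.eventually_norm_D_sub_le hr (half_pos hδ),
    f.eventually_norm_D_sub_le hr (half_pos hc),
    f.eventually_norm_D_sub_le hr (half_pos (sub_pos.2 hl))] with g h1 h2 h3
  refine ⟨fun x => ?_, fun x v => ?_, fun x hx v => ?_⟩
  · refine (hthick (Metric.mem_thickening_iff.2 ⟨f.D x, mem_range_self x, ?_⟩) :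
      σ < |(g.D x).det|).le
    rw [dist_comm, dist_eq_norm]
    exact (h1 x).trans_lt (half_lt_self hδ)
  · convert hpert (hcD x v) (h2 x) using 2
    ring
  · convert hpert (le_norm_of_lt_minNorm (by linarith) (hlU x hx) v) (h3 x) using 2
    ring

theorem IsLift.inverseBounds {g : TorusEndo n r} {e : Cover n ≃ₜ Cover n} (he : g.IsLift e)
    (hr : 1 ≤ r) {U : Set (Torus n)} {c l : ℝ} (hc : 0 < c) (hl : 0 < l)
    (hgc : ∀ x v, c * ‖v‖ ≤ ‖g.D x v‖) (hgl : ∀ x, proj x ∉ U → ∀ v, l * ‖v‖ ≤ ‖g.D x v‖) :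
    InverseBounds e (proj ⁻¹' U) c⁻¹ l⁻¹ := by
  intro v
  obtain ⟨H, hH, hHc⟩ := e.exists_hasFDerivAt_symm v (he.hasFDerivAt hr _) hc (hgc _)
  refine ⟨H, hH, hHc, fun hv => ?_⟩
  obtain ⟨H', hH', hHl⟩ := e.exists_hasFDerivAt_symm v (he.hasFDerivAt hr _) hl (hgl _ hv)
  rwa [hH.unique hH']

/-- The bound determines how closely an arc must follow `h(K)` for the orbits to stay close during a
given number of steps. -/
theorem IsLift.exists_dist_iterate_le {f : TorusEndo n r} {F : Cover n → Cover n}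
    (hF : f.IsLift F) (hr : 1 ≤ r) :
    ∃ M, 1 ≤ M ∧ ∀ k x y, dist (F^[k] x) (F^[k] y) ≤ M ^ k * dist x y := by
  obtain ⟨M, hM⟩ := (f.isCompact_range_D hr).isBounded.exists_norm_le
  have hstep : ∀ x y, dist (F x) (F y) ≤ max 1 M * dist x y := fun x y => by
    rw [dist_eq_norm, dist_eq_norm]
    exact convex_univ.norm_image_sub_le_of_norm_hasFDerivWithin_le
      (fun z _ => (hF.hasFDerivAt hr z).hasFDerivWithinAt)
      (fun z _ => (hM _ (mem_range_self z)).trans (le_max_right _ _)) (mem_univ y) (mem_univ x)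
  refine ⟨max 1 M, le_max_left _ _, fun k x y => ?_⟩
  induction k with
  | zero => simp
  | succ k ih =>
    rw [Function.iterate_succ_apply', Function.iterate_succ_apply', pow_succ', mul_assoc]
    exact (hstep _ _).trans (mul_le_mul_of_nonneg_left ih (by positivity))

end TorusEndo

/-! ### Growth of the images of open sets -/

section Growth

variable {n : ℕ} {a : Cover n} {U : Set (Torus n)}

/-- Every open set has an iterate which contains a ball of radius `ρ`. -/
def EventuallyContainsBall (e : Cover n ≃ₜ Cover n) (ρ : ℝ) : Prop :=
  ∀ V : Set (Cover n), IsOpen V → IsPathConnected V →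
    ∃ m z, Metric.ball z ρ ⊆ e^[m] '' V

theorem supDist_le_one_of_supDiam_lt (h : supDiam (frameLift a U) < 1) {x y : Cover n}
    (hx : x ∈ frameLift a U) (hy : y ∈ frameLift a U) : supDist x y ≤ 1 := by
  have h1 : supEDist x y ≤ supDiam (frameLift a U) :=
    le_iSup₂_of_le x hx (le_iSup₂_of_le y hy le_rfl)
  rw [supEDist_eq] at h1
  exact (ENNReal.ofReal_le_one).1 (h1.trans h.le)

theorem internalDiam_le (k : Fin n → ℤ) (hk : k ≠ 0) {x y : Cover n}
    (hx : x ∈ frameLift a U) (hy : y ∈ frameLift a U) :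
    internalDiam a U ≤ ENNReal.ofReal (supDist x (y + intVec k)) := by
  rw [← supEDist_eq]
  exact iInf₂_le_of_le k hk (iInf₂_le_of_le x hx (iInf₂_le_of_le y hy le_rfl))

/-- A point is compared with its own translate by `(1, …, 1)`. -/
theorem internalDiam_le_one [Nonempty (Fin n)] (h : (frameLift a U).Nonempty) :
    internalDiam a U ≤ 1 := by
  obtain ⟨x, hx⟩ := h
  obtain ⟨i⟩ := ‹Nonempty (Fin n)›
  refine (internalDiam_le (fun _ => 1) (fun h0 => one_ne_zero (congrFun h0 i)) hx hx).trans
    (ENNReal.ofReal_le_one.2 ((dist_pi_le_iff zero_le_one).2 fun j => ?_))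
  simp

/-- The lift of `U` stays at a positive distance from that of the complement of a neighbourhood of
its closure. -/
theorem exists_le_dist_of_closure_subset {U U' : Set (Torus n)} (hU' : IsOpen U')
    (h : closure U ⊆ U') : ∃ η > 0, ∀ x w : Cover n, proj x ∈ U'ᶜ → proj w ∈ U → η ≤ dist x w := by
  obtain ⟨η, hη, hthick⟩ := isClosed_closure.isCompact.exists_thickening_subset_open hU' h
  refine ⟨η, hη, fun x w hx hw => ?_⟩
  by_contra! hlt
  exact hx (hthick (Metric.mem_thickening_iff.2
    ⟨proj w, subset_closure hw, (dist_proj_le x w).trans_lt hlt⟩))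

/-- If the inverse is contracting everywhere then every open set grows to a definite size. -/
theorem InverseBounds.eventuallyContainsBall_of_empty {e : Cover n ≃ₜ Cover n} {L κ ρ : ℝ}
    (hb : InverseBounds e ∅ L κ) (hκ0 : 0 < κ) (hκ1 : κ < 1) (hρ : L * ρ < 1) :
    EventuallyContainsBall e ρ := by
  intro V hV hVc
  obtain ⟨y, hy⟩ := hVc.nonempty
  obtain ⟨s, hs, hsV⟩ := Metric.isOpen_iff.1 hV y hy
  have htend : Tendsto (fun m : ℕ => ρ * κ ^ m) atTop (𝓝 (ρ * 0)) :=
    (tendsto_pow_atTop_nhds_zero_of_lt_one hκ0.le hκ1).const_mul ρ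
  rw [mul_zero] at htend
  obtain ⟨m, hm⟩ := (htend.eventually_le_const hs).exists
  exact ⟨m, _, hb.ball_subset_iterate_image hκ0 hκ1.le hρ hsV m (by simp) le_rfl hm⟩

/-- The main mechanism: under a perturbation `e'` of a lift `e` of `f`, every open set grows until
it contains a large arc outside the lift `W` of `U`, hence a point whose orbit stays away from `W`,
around which the images contain balls of a definite size. -/
theorem TorusEndo.IsLift.eventuallyContainsBall {r : ℕ∞} {f : TorusEndo n r}
    {e e' : Cover n ≃ₜ Cover n} (hn : 0 < n) (he : f.IsLift e) (hr : 1 ≤ r) {U' : Set (Torus n)}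
    {L κ η ε δ δ₀ D : ℝ} (hκ0 : 0 < κ) (hκ1 : κ < 1)
    (hb : InverseBounds e (proj ⁻¹' U) L κ) (hb' : InverseBounds e' (proj ⁻¹' U) L κ)
    {D' : Cover n → Cover n →L[ℝ] Cover n} (hD' : ∀ x, HasFDerivAt e' (D' x) x) {σ : ℝ}
    (hσ : 1 < σ) (hdet : ∀ x, σ ≤ |(D' x).det|)
    (hUne : (proj ⁻¹' U : Set (Cover n)).Nonempty)
    (hdiam : ∀ x ∈ frameLift a U, ∀ y ∈ frameLift a U, supDist x y ≤ 1)
    (hsep : ∀ k : Fin n → ℤ, k ≠ 0 → ∀ x ∈ frameLift a U, ∀ y ∈ frameLift a U,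
      D ≤ supDist x (y + intVec k)) (hD1 : D ≤ 1) (hδ₀ : 0 < δ₀) (hδ₀D : δ₀ + 6 * η < D)
    (hη : 0 < η) (hε : 0 < ε) (hεη : ε ≤ η) (hεδ : κ * (ε + δ) ≤ ε) (hδ0 : 0 ≤ δ)
    (hLε : L * (ε + δ) < η) (hdist : ∀ x, dist (e' x) (e x) ≤ δ)
    (hfar : ∀ x w : Cover n, proj x ∈ U'ᶜ → proj w ∈ U → 4 * η ≤ dist x w)
    (harc : ∀ γ : C(unitInterval, Cover n), IsArcLift γ → (∀ t, proj (γ t) ∈ Uᶜ) →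
      ENNReal.ofReal δ₀ < supDiam (range γ) →
      ∃ t, ∀ k : ℕ, 1 ≤ k → f^[k] (proj (γ t)) ∈ U'ᶜ) :
    EventuallyContainsBall e' ε := by
  intro V hV hVc
  obtain ⟨N, p, hp, q, hq, hpq⟩ := exists_le_dist_iterate_of_volume_expanding hD' hσ hdet hV
    hVc.nonempty (n * 8)
  have hpq8 : 8 ≤ supDist (e'^[N] p) (e'^[N] q) := by
    have h1 := hpq.trans (dist_le_mul_supDist _ _)
    exact le_of_mul_le_mul_left h1 (by exact_mod_cast hn)
  have hO : IsOpen (e'^[N] '' V) := isOpenMap_iterate e'.isOpenMap N V hV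
  obtain ⟨K, hKO, hKc, hKp, hKfar, p', hp', q', hq', hpq'⟩ :=
    exists_isCompact_isPreconnected_far hdiam hsep hD1 (s := 2 * η) (by linarith) (by linarith)
      (hVc.image (e'.continuous.iterate N)) (mem_image_of_mem _ hp) (mem_image_of_mem _ hq) hpq8
  obtain ⟨s, hs, hsO⟩ := hKc.exists_thickening_subset_open hO hKO
  have htend : Tendsto (fun m : ℕ => ε * κ ^ m) atTop (𝓝 (ε * 0)) :=
    (tendsto_pow_atTop_nhds_zero_of_lt_one hκ0.le hκ1).const_mul ε
  rw [mul_zero] at htend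
  -- The number `m` of steps is what a ball of radius `s` needs to grow to radius `ε`. It depends on
  -- `V`, whereas `ε`, `δ` and `η` do not.
  obtain ⟨m, hm⟩ := (htend.eventually_le_const hs).exists
  obtain ⟨h, hhc, hhd, hsh⟩ := hb.exists_shadow hκ0.le hε.le hεη hη hεδ hLε hdist m
  obtain ⟨M, hM1, hM⟩ := he.exists_dist_iterate_le hr
  have hM0 : 0 < M ^ m := by positivity
  -- Points at distance less than `ζ` stay within `η / 2` of each other for `m` steps of `e`, so the
  -- margin `4 * η` around the orbit in `U'ᶜ` leaves the `3 * η` that shadowing requires.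
  let ζ : ℝ := η / 2 / M ^ m
  have hζ : 0 < ζ := by positivity
  have hMζ : ∀ k ≤ m, M ^ k * ζ ≤ η / 2 := fun k hk => by
    have h1 : M ^ k ≤ M ^ m := pow_le_pow_right₀ hM1 hk
    calc M ^ k * ζ ≤ M ^ m * ζ := mul_le_mul_of_nonneg_right h1 hζ.le
      _ = η / 2 := by simp only [ζ]; field_simp
  have hζη : ζ ≤ η / 2 := by simpa using hMζ 0 m.zero_le
  have hKdist : ∀ y ∈ K, ∀ w, proj w ∈ U → 2 * η ≤ dist y w := fun y hy w hw =>
    (hKfar y hy w hw).trans (supDist_le_dist _ _)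
  have hjoin : ArcJoined (Metric.thickening ζ (h '' K)) (h p') (h q') :=
    (hKp.image h hhc.continuousOn).arcJoined Metric.isOpen_thickening
      (Metric.self_subset_thickening hζ _) (mem_image_of_mem _ hp') (mem_image_of_mem _ hq')
  have hlong : δ₀ < supDist (h p') (h q') := by
    have h1 := supDist_triangle p' (h p') q'
    have h2 := supDist_triangle (h p') (h q') q'
    have h3 := (supDist_le_dist (h p') p').trans (hhd p')
    have h4 := (supDist_le_dist (h q') q').trans (hhd q')
    rw [supDist_comm] at h3
    linarith
  obtain ⟨γ, hγ, hγK, hγd⟩ := hjoin.exists_isArcLift hδ₀.le (by linarith) hlong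
  have hnear : ∀ t, ∃ y ∈ K, dist (γ t) (h y) < ζ := fun t => by
    obtain ⟨_, ⟨y, hy, rfl⟩, hty⟩ := Metric.mem_thickening_iff.1 (hγK t)
    exact ⟨y, hy, hty⟩
  -- The arc avoids `U`: it is within `ζ + ε < 2 * η` of `K`, which is at least `2 * η` away from
  -- the lift of `U`.
  obtain ⟨t, ht⟩ := harc γ hγ (fun t htU => by
    obtain ⟨y, hy, hty⟩ := hnear t
    have h1 := hKdist y hy _ htU
    have h2 := dist_triangle_right y (γ t) (h y)
    rw [dist_comm y (h y)] at h2
    linarith [hhd y]) hγd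
  obtain ⟨y, hy, hty⟩ := hnear t
  have horbit := hsh y ((Metric.le_infDist hUne).2 fun w hw => hKdist y hy w hw)
    fun k hk1 hkm => (Metric.le_infDist hUne).2 fun w hw => by
      have h1 := ht k hk1
      rw [← he.iterate] at h1
      have h2 := hfar _ w h1 hw
      have h3 := (hM k (γ t) (h y)).trans (mul_le_mul_of_nonneg_left hty.le (by positivity))
      have h4 := hMζ k hkm
      linarith [dist_triangle (e^[k] (γ t)) (e^[k] (h y)) w]
  have hball : Metric.ball y s ⊆ e'^[N] '' V :=
    (Metric.ball_subset_thickening hy s).trans hsO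
  have hLε' : L * ε < η := lt_of_le_of_lt
    (mul_le_mul_of_nonneg_left (by linarith) hb.nonneg) hLε
  have hfinal := hb'.ball_subset_iterate_image hκ0 hκ1.le hLε' hball m (fun k hk w hw => by
    have h1 := (horbit k hk.le).trans (Metric.infDist_le_dist_of_mem hw)
    rw [dist_comm]
    linarith) le_rfl hm
  refine ⟨m + N, e'^[m] y, ?_⟩
  rwa [Function.iterate_add, image_comp]

/-- Growth of open sets and uniform density of the pre-orbits give dense pre-orbits. -/
theorem TorusEndo.IsLift.dense_preorbit {r : ℕ∞} {g : TorusEndo n r} {e : Cover n ≃ₜ Cover n}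
    (he : g.IsLift e) {ρ : ℝ} (hball : EventuallyContainsBall e ρ)
    (hunif : ∀ (z : Cover n) (x : Torus n), ∃ k, ∃ w ∈ Metric.ball z ρ, g^[k] (proj w) = x)
    (x : Torus n) : Dense (g.preorbit x) := by
  refine dense_iff_inter_open.2 fun T hT hne => ?_
  obtain ⟨y, hy⟩ := hne
  obtain ⟨y, rfl⟩ := proj_surjective y
  obtain ⟨s, hs, hsT⟩ := Metric.isOpen_iff.1 (hT.preimage continuous_proj) y hy
  obtain ⟨m, z, hz⟩ := hball (Metric.ball y s) Metric.isOpen_ball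
    ((convex_ball y s).isPathConnected ⟨y, Metric.mem_ball_self hs⟩)
  obtain ⟨k, w, hw, hwx⟩ := hunif z x
  obtain ⟨v, hv, rfl⟩ := hz hw
  refine ⟨proj v, hsT hv, k + m, ?_⟩
  rw [Function.iterate_add_apply, ← he.iterate, hwx]

end Growth

/-! ### Choice of the constants and conclusion -/

/-- Hypotheses on `f` under which open sets grow to a definite size, for all perturbations of `f`
with the same bounds. -/
theorem TorusEndo.exists_eventuallyContainsBall {n : ℕ} {r : ℕ∞} (hn : 0 < n) (hr : 1 ≤ r)
    {f : TorusEndo n r} {e : Cover n ≃ₜ Cover n} (he : f.IsLift e) {U₀ U₁ : Set (Torus n)}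
    {a : Cover n} (hdiam : supDiam (frameLift a U₀) < 1) {δ₀ : ℝ} (hδ₀ : 0 < δ₀)
    (hδ₀' : ENNReal.ofReal δ₀ < internalDiam a U₀) (hU₁ : IsOpen U₁) (hU₀₁ : closure U₀ ⊆ U₁)
    (harc : ∀ γ : C(unitInterval, Cover n), IsArcLift γ → (∀ t, proj (γ t) ∈ U₀ᶜ) →
      ENNReal.ofReal δ₀ < supDiam (range γ) →
      ∃ t, ∀ k : ℕ, 1 ≤ k → f^[k] (proj (γ t)) ∈ U₁ᶜ)
    {L κ : ℝ} (hκ0 : 0 < κ) (hκ1 : κ < 1) (hb : InverseBounds e (proj ⁻¹' U₀) L κ) {σ : ℝ}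
    (hσ : 1 < σ) :
    ∃ ρ > 0, ∃ δ > 0, ∀ (g : TorusEndo n r) (e' : Cover n ≃ₜ Cover n), g.IsLift e' →
      (∀ x, σ ≤ |(g.D x).det|) → InverseBounds e' (proj ⁻¹' U₀) L κ →
      (∀ x, dist (e' x) (e x) ≤ δ) → EventuallyContainsBall e' ρ := by
  have hL : 0 ≤ L := hb.nonneg
  -- If `U₀` is empty its internal diameter is `⊤` and `Metric.infDist` to its lift is 0 by
  -- convention, so this uniformly expanding case is treated apart.
  rcases (proj ⁻¹' U₀ : Set (Cover n)).eq_empty_or_nonempty with hW | hW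
  · refine ⟨(L + 1)⁻¹, by positivity, 1, one_pos, fun g e' _ _ hb' _ => ?_⟩
    rw [hW] at hb'
    refine hb'.eventuallyContainsBall_of_empty hκ0 hκ1 ?_
    rw [← div_eq_mul_inv, div_lt_one (by positivity)]
    linarith
  have hne : (frameLift a U₀).Nonempty := by
    obtain ⟨w, hw⟩ := hW
    obtain ⟨-, x, hx, -⟩ := exists_mem_frameLift (a := a) hw
    exact ⟨x, hx⟩
  have : Nonempty (Fin n) := ⟨⟨0, hn⟩⟩
  have hD1 : internalDiam a U₀ ≤ 1 := internalDiam_le_one hne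
  have hDtop : internalDiam a U₀ ≠ ⊤ := (hD1.trans_lt ENNReal.one_lt_top).ne
  obtain ⟨D, hD⟩ : ∃ D, D = (internalDiam a U₀).toReal := ⟨_, rfl⟩
  have hδD : δ₀ < D := hD ▸ (ENNReal.ofReal_lt_iff_lt_toReal hδ₀.le hDtop).1 hδ₀'
  have hsep : ∀ k : Fin n → ℤ, k ≠ 0 → ∀ x ∈ frameLift a U₀, ∀ y ∈ frameLift a U₀,
      D ≤ supDist x (y + intVec k) := fun k hk x hx y hy => by
    rw [hD]
    exact ENNReal.toReal_le_of_le_ofReal dist_nonneg (internalDiam_le k hk hx hy)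
  have hD1' : D ≤ 1 := by
    rw [hD]
    exact ENNReal.toReal_le_of_le_ofReal zero_le_one (by simpa using hD1)
  obtain ⟨η₀, hη₀, hfar⟩ := exists_le_dist_of_closure_subset hU₁ hU₀₁
  -- Of the `6 * η`, four are lost in keeping `K` at distance `2 * η` from the lift of `U₀`, and two
  -- in the displacement of its end points by `h`.
  obtain ⟨η, hη, hηη₀, hηD⟩ : ∃ η > 0, 4 * η ≤ η₀ ∧ δ₀ + 6 * η < D := by
    refine ⟨min (η₀ / 4) ((D - δ₀) / 8), lt_min (by linarith) (by linarith), ?_, ?_⟩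
    · linarith [min_le_left (η₀ / 4) ((D - δ₀) / 8)]
    · linarith [min_le_right (η₀ / 4) ((D - δ₀) / 8)]
  obtain ⟨ε, hε, hεη, hLε⟩ : ∃ ε > 0, ε ≤ η ∧ L * (2 * ε) < η := by
    refine ⟨η / (2 * (L + 1)), by positivity, ?_, ?_⟩
    · exact div_le_self hη.le (by linarith)
    · have h1 : L * (2 * (η / (2 * (L + 1)))) = η * (L / (L + 1)) := by field_simp
      rw [h1]
      exact mul_lt_of_lt_one_right hη ((div_lt_one (by positivity)).2 (by linarith))
  -- The perturbation size is `δ = (1 - κ) * ε`, so that `κ * (ε + δ) ≤ κ * ε + δ = ε`: contraction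
  -- absorbs the error made at each step.
  have hδ : 0 < (1 - κ) * ε := mul_pos (sub_pos.2 hκ1) hε
  have hδε : (1 - κ) * ε ≤ ε := mul_le_of_le_one_left hε.le (by linarith)
  refine ⟨ε, hε, (1 - κ) * ε, hδ, fun g e' he' hdet hb' hdist => ?_⟩
  refine he.eventuallyContainsBall (U := U₀) hn hr hκ0 hκ1 hb hb' (he'.hasFDerivAt hr) hσ hdet hW
    (fun x hx y hy => supDist_le_one_of_supDiam_lt hdiam hx hy) hsep hD1' hδ₀ hηD hη hε hεη ?_
    hδ.le ?_ hdist (fun x w hx hw => hηη₀.trans (hfar x w hx hw)) harc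
  · have h1 : κ * ((1 - κ) * ε) ≤ (1 - κ) * ε := mul_le_of_le_one_left hδ.le hκ1.le
    linarith
  · exact lt_of_le_of_lt (mul_le_mul_of_nonneg_left (by linarith) hL) hLε

theorem mainTheorem1 (n : ℕ) (hn : 2 ≤ n) (r : ℕ∞) (hr : 1 ≤ r) (f : TorusEndo n r)
    (hvol : f.VolumeExpanding) (hdense : ∀ x, Dense (f.preorbit x))
    -- hypothesis 1; the fundamental domain of the torus is `a + [0,1)ⁿ`
    (U₀ : Set (Torus n)) (hU₀ : IsOpen U₀) (hexp : f.ExpandingOn U₀ᶜ)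
    (a : Cover n) (hdiam : supDiam (frameLift a U₀) < 1)
    -- hypothesis 2; the diameter of an arc is measured on its lift
    (δ₀ : ℝ) (hδ₀ : 0 < δ₀) (hδ₀' : ENNReal.ofReal δ₀ < internalDiam a U₀)
    (U₁ : Set (Torus n)) (hU₁ : IsOpen U₁) (hU₀₁ : closure U₀ ⊆ U₁)
    (harc : ∀ γ : C(unitInterval, Cover n), IsArcLift γ → (∀ t, proj (γ t) ∈ U₀ᶜ) →
      ENNReal.ofReal δ₀ < supDiam (range γ) →
      ∃ t, ∀ k : ℕ, 1 ≤ k → f^[k] (proj (γ t)) ∈ U₁ᶜ)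
    -- hypothesis 3
    (hpre : ∀ z ∈ U₁ᶜ, ∃ w ∈ U₁ᶜ, f w = z) :
    (∀ᶠ g in 𝓝 f, ∀ x, Dense (g.preorbit x)) ∧ f.RobustlyTransitive := by
  have hn0 : 0 < n := by omega
  obtain ⟨σ, hσ, c, hc, l, hl, hbd⟩ := f.exists_eventually_bounds hr hvol hexp
  have hdet0 : ∀ {g : TorusEndo n r}, (∀ x, σ ≤ |(g.D x).det|) → ∀ x, (g.D x).det ≠ 0 :=
    fun h x h0 => by
      have := h x
      rw [h0, abs_zero] at this
      linarith
  have hl0 : 0 < l := by linarith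
  obtain ⟨hfσ, hfc, hfl⟩ := hbd.self_of_nhds
  obtain ⟨e, he⟩ := f.isLift_lift.exists_homeomorph hr (hdet0 hfσ)
  have heL : f.IsLift e := he ▸ f.isLift_lift
  have hb := heL.inverseBounds hr hc hl0 hfc hfl
  obtain ⟨ρ, hρ, δ, hδ, hgrow⟩ := TorusEndo.exists_eventuallyContainsBall hn0 hr heL hdiam hδ₀
    hδ₀' hU₁ hU₀₁ harc (inv_pos.2 hl0) (inv_lt_one_of_one_lt₀ hl) hb hσ
  obtain ⟨δ', hδ', hunif⟩ := TorusEndo.exists_robust_uniform_preorbit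
    (f.isLocalHomeomorph hr (hdet0 hfσ)).isOpenMap hdense heL hb hρ
  have hmain : ∀ᶠ g in 𝓝 f, ∀ x, Dense (g.preorbit x) := by
    filter_upwards [hbd, f.eventually_exists_isLift heL (lt_min hδ hδ')]
      with g ⟨hgσ, hgc, hgl⟩ ⟨G, hG, hGd⟩ x
    obtain ⟨e', rfl⟩ := hG.exists_homeomorph hr (hdet0 hgσ)
    exact hG.dense_preorbit
      (hgrow g e' hG hgσ (hG.inverseBounds hr hc hl0 hgc hgl)
        fun y => (hGd y).trans (min_le_left _ _))
      (hunif g e' hG fun y => (hGd y).trans (min_le_right _ _)) x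
  exact ⟨hmain, hmain.mono fun g hg => g.transitive_of_dense_preorbit hg⟩
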